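/- **Model.** Let $(\mathbf X_i,\mathbf Y_i)$, $i\ge 1$, be i.i.d. copies of $(\mathbf X,\mathbf Y)$, where $\mathbf X$ is a $q\times p$ covariate matrix with rows $\mathbf X_j^T$ and values in $\mathcal X$, and $\mathbf Y=(Y_1,\dots,Y_q)^T$ is integrable. For a true parameter $\boldsymbol\beta_0\in\mathbb R^p$, a link function $h$ (a homeomorphism between open sets of reals with continuously differentiable inverse), a measurable $v>0$ and $\psi>0$, put $\mu_j(\boldsymbol\beta)=h^{-1}(\mathbf X_j^T\boldsymbol\beta)$, $\boldsymbol\mu=(\mu_1,\dots,\mu_q)^T$, $\dot{\boldsymbol\mu}=\partial\boldsymbol\mu/\partial\boldsymbol\beta^T$ and $\mathbf A(\boldsymbol\beta)=\mathrm{diag}(\psi v(\mu_j(\boldsymbol\beta)))$; the marginal model is $E(Y_j\mid\mathbf X)=\mu_j(\boldsymbol\beta_0)$ and $\mathrm{Var}(Y_j\mid\mathbf X_j)=\psi v(\mu_j(\boldsymbol\beta_0))$. Let $\mathbf M_1,\dots,\mathbf M_L$ be known $q\times q$ matrices, some linear combination of which is the inverse of a positive definite correlation matrix. Let $\Omega_1,\dots,\Omega_K$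 be a measurable partition of $\mathcal X$ with known subgroup means $\boldsymbol\phi_k=E(\mathbf Y\mid\mathbf X\in\Omega_k)$. **Moment functions and estimator.** Let $\mathbf S(\boldsymbol\beta)$ be the stack of the vectors $\dot{\boldsymbol\mu}^T\mathbf W^{(l)}(\mathbf Y-\boldsymbol\mu)$, $\mathbf W^{(l)}=\mathbf A^{-1/2}\mathbf M_l\mathbf A^{-1/2}$, $l\le L$; let $\boldsymbol\Psi(\boldsymbol\beta)$ be the stack of $I(\mathbf X\in\Omega_k)(\boldsymbol\mu-\boldsymbol\phi_k)$, $k\le K$; and let $\mathbf g=(\mathbf S^T,\boldsymbol\Psi^T)^T$. Write $\mathbf g_n(\boldsymbol\beta)$ and $\boldsymbol\Sigma_n(\boldsymbol\beta)$ for the sample means over $i\le n$ of $\mathbf g$ and $\mathbf g\mathbf g^T$, $\mathbf G_n=\partial\mathbf g_n/\partial\boldsymbol\beta^T$, and $Q_n=\mathbf g_n^T\boldsymbol\Sigma_n^{-1}\mathbf g_n$ (defined where $\boldsymbol\Sigma_n(\boldsymbol\beta)$ is nonsingular). Let $\Theta\subset\mathbb R^p$ be compact, let $V\supseteq\Theta$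 be open, and suppose that $\mathbf x_j^T\boldsymbol\beta$ lies in the range of $h$ for all $\mathbf x\in\mathcal X$, $\boldsymbol\beta\in V$, $j\le q$. The GMM estimator $\widehat{\boldsymbol\beta}_{\rm GMM}$ is a random vector that, with probability tending to one, minimizes $Q_n$ over $\Theta$. **Conditions.** - C1. $\boldsymbol\beta_0$ is an interior point of $\Theta$, $E\,\mathbf g(\boldsymbol\beta)$ exists for $\boldsymbol\beta\in\Theta$, and $\boldsymbol\beta_0$ is its unique zero in $\Theta$. - C2. $\boldsymbol\Sigma_1=E\{\mathbf S(\boldsymbol\beta_0)\mathbf S(\boldsymbol\beta_0)^T\}$ and $\boldsymbol\Sigma_2=E\{\boldsymbol\Psi(\boldsymbol\beta_0)\boldsymbol\Psi(\boldsymbol\beta_0)^T\}$ are finite and positive definite. - C3. $\mathbf A(\boldsymbol\beta)$ is twice continuously differentiable in $\boldsymbol\beta\in V$ and is bounded together with its derivatives up to the second order, uniformly in $\boldsymbol\beta\in V$ and in the covariates. - C4. Almost surely, $\boldsymbol\Sigma_n(\boldsymbol\beta)$ is twice continuously differentiable on $V$, and there is a matrix $\boldsymbol\Sigma(\boldsymbol\beta)$,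 continuous and positive definite at $\boldsymbol\beta_0$, with $\sup_{\boldsymbol\beta\in V}\|\boldsymbol\Sigma_n(\boldsymbol\beta)-\boldsymbol\Sigma(\boldsymbol\beta)\|=o_p(1)$. - C5. Almost surely, $\mathbf g_n(\boldsymbol\beta)$ is twice continuously differentiable on $V$, and there are a vector $\mathbf g(\boldsymbol\beta)$ and a matrix $\mathbf G(\boldsymbol\beta)$, both continuous at $\boldsymbol\beta_0$, with $\sup_{\boldsymbol\beta\in V}\|\mathbf g_n(\boldsymbol\beta)-\mathbf g(\boldsymbol\beta)\|=o_p(1)$ and $\sup_{\boldsymbol\beta\in V}\|\mathbf G_n(\boldsymbol\beta)-\mathbf G(\boldsymbol\beta)\|=o_p(1)$; moreover $E\|\partial\mathbf g(\boldsymbol\beta_0)/\partial\boldsymbol\beta^T\|<\infty$. **Theorem.** Let $\mathbf B_1$ be the $pL\times p$ matrix whose row $(l,m)$, column $h$ entry is $-E\{\sum_{j,k}\frac{\partial\mu_j}{\partial\beta_m}w^{(l)}_{jk}\frac{\partial\mu_k}{\partial\beta_h}\}$ at $\boldsymbol\beta_0$, where $w^{(l)}_{jk}$ are the entries of $\mathbf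 W^{(l)}$, and let $\mathbf B_2$ be the $Kq\times p$ matrix with blocks $E\{I(\mathbf X\in\Omega_k)\,\partial\boldsymbol\mu/\partial\beta_h\}$ at $\boldsymbol\beta_0$. Under C1–C5, $\mathbf B_1^T\boldsymbol\Sigma_1^{-1}\mathbf B_1+\mathbf B_2^T\boldsymbol\Sigma_2^{-1}\mathbf B_2$ is positive definite (in particular invertible), and $$\sqrt n\,(\widehat{\boldsymbol\beta}_{\rm GMM}-\boldsymbol\beta_0)\xrightarrow{\ \mathcal D\ }N_p\Big(\mathbf 0,\big(\mathbf B_1^T\boldsymbol\Sigma_1^{-1}\mathbf B_1+\mathbf B_2^T\boldsymbol\Sigma_2^{-1}\mathbf B_2\big)^{-1}\Big).$$ -/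

import Mathlib

open MeasureTheory ProbabilityTheory Filter Topology Matrix

noncomputable section

namespace MarginalGMM

/-- The known ingredients of a marginal model with subgroup auxiliary information: `p` covariates,
`q` repeated measurements per subject, `L` basis matrices, `K` subgroups. The link function is a
homeomorphism from an open set of possible means onto an open set of linear predictors. -/
structure Spec (p q L K : ℕ) where
  /-- the link function `h` -/
  link : OpenPartialHomeomorph ℝ ℝ
  /-- the variance function `v` -/
  v : ℝ → ℝ
  /-- the scale parameter `ψ` -/
  ψ : ℝ
  /-- the basis matrices of the inverse working correlation matrix -/
  M : Fin L → Matrix (Fin q) (Fin q) ℝ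
  /-- the subgroups of the covariate space -/
  grp : Fin K → Set (Fin q → Fin p → ℝ)
  /-- the known subgroup means of the response -/
  φ : Fin K → Fin q → ℝ

/-- Index set of the `pL + Kq` estimating equations. -/
abbrev MIdx (p q L K : ℕ) : Type := (Fin L × Fin p) ⊕ (Fin K × Fin q)

/-- Euclidean norm of a vector. -/
def vnorm {ι : Type*} [Fintype ι] (u : ι → ℝ) : ℝ := √(∑ a, u a ^ 2)

/-- Euclidean (Frobenius) norm of a matrix. -/
def mnorm {ι κ : Type*} [Fintype ι] [Fintype κ] (A : Matrix ι κ ℝ) : ℝ :=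
  √(∑ a, ∑ b, A a b ^ 2)

/-- `sup_{β ∈ V} d n β = o_P(1)` for nonnegative random functions `d n` of `β`; the sets need not
be measurable, `P` is read as an outer measure. -/
def SupTendstoZero {E Ω : Type*} [MeasurableSpace Ω] (P : Measure Ω) (V : Set E)
    (d : ℕ → E → Ω → ℝ) : Prop :=
  ∀ ε : ℝ, 0 < ε → Tendsto (fun n => P {ω | ∃ β ∈ V, ε ≤ d n β ω}) atTop (𝓝 0)

namespace Spec

variable {p q L K : ℕ} (D : Spec p q L K)

/-- The mean `μ_j = h⁻¹(x_jᵀ β)` of the `j`-th response. -/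
def mu (β : EuclideanSpace ℝ (Fin p)) (x : Fin q → Fin p → ℝ) (j : Fin q) : ℝ :=
  D.link.symm (∑ k, x j k * β k)

/-- The `j`-th diagonal entry `ψ v(μ_j)` of the marginal variance matrix `A`. -/
def A (β : EuclideanSpace ℝ (Fin p)) (x : Fin q → Fin p → ℝ) (j : Fin q) : ℝ :=
  D.ψ * D.v (D.mu β x j)

/-- The `q × p` matrix `∂μ / ∂βᵀ`. -/
def muDot (β : EuclideanSpace ℝ (Fin p)) (x : Fin q → Fin p → ℝ) :
    Matrix (Fin q) (Fin p) ℝ :=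
  Matrix.of fun j k => fderiv ℝ (fun b => D.mu b x j) β (EuclideanSpace.single k 1)

/-- `A^{-1/2} M_l A^{-1/2}`. -/
def W (l : Fin L) (β : EuclideanSpace ℝ (Fin p)) (x : Fin q → Fin p → ℝ) :
    Matrix (Fin q) (Fin q) ℝ :=
  Matrix.diagonal (fun j => (√(D.A β x j))⁻¹) * D.M l *
    Matrix.diagonal (fun j => (√(D.A β x j))⁻¹)

/-- The QIF moment function `S`, stacked over `l`. -/
def qif (β : EuclideanSpace ℝ (Fin p)) (x : Fin q → Fin p → ℝ) (y : Fin q → ℝ) :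
    Fin L × Fin p → ℝ :=
  fun a => ((D.muDot β x)ᵀ *ᵥ (D.W a.1 β x *ᵥ (y - D.mu β x))) a.2

open Classical in
/-- The auxiliary moment function `Ψ`, with blocks `Ψ_k = I(x ∈ Ω_k) (μ(β, x) - φ_k)`. -/
def aux (β : EuclideanSpace ℝ (Fin p)) (x : Fin q → Fin p → ℝ) : Fin K × Fin q → ℝ :=
  fun a => if x ∈ D.grp a.1 then D.mu β x a.2 - D.φ a.1 a.2 else 0

/-- The stacked moment function `g = (S, Ψ)`. -/
def moment (β : EuclideanSpace ℝ (Fin p)) (x : Fin q → Fin p → ℝ) (y : Fin q → ℝ) :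
    MIdx p q L K → ℝ :=
  Sum.elim (D.qif β x y) (D.aux β x)

variable {Ω : Type*} (X : ℕ → Ω → Fin q → Fin p → ℝ) (Y : ℕ → Ω → Fin q → ℝ)

/-- The sample moment `g_n(β)`. -/
def gbar (n : ℕ) (β : EuclideanSpace ℝ (Fin p)) (ω : Ω) : MIdx p q L K → ℝ :=
  (n : ℝ)⁻¹ • ∑ i ∈ Finset.range n, D.moment β (X i ω) (Y i ω)

/-- The sample second moment matrix `Σ_n(β)`. -/
def Sig (n : ℕ) (β : EuclideanSpace ℝ (Fin p)) (ω : Ω) :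
    Matrix (MIdx p q L K) (MIdx p q L K) ℝ :=
  (n : ℝ)⁻¹ • ∑ i ∈ Finset.range n,
    Matrix.vecMulVec (D.moment β (X i ω) (Y i ω)) (D.moment β (X i ω) (Y i ω))

/-- The objective `Q_n(β) = g_n(β)ᵀ Σ_n(β)⁻¹ g_n(β)`, meaningful where `Σ_n(β)` is invertible. -/
def Q (n : ℕ) (β : EuclideanSpace ℝ (Fin p)) (ω : Ω) : ℝ :=
  D.gbar X Y n β ω ⬝ᵥ ((D.Sig X Y n β ω)⁻¹ *ᵥ D.gbar X Y n β ω)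

/-- The Jacobian `G_n(β) = ∂g_n(β) / ∂βᵀ`. -/
def Jac (n : ℕ) (β : EuclideanSpace ℝ (Fin p)) (ω : Ω) : Matrix (MIdx p q L K) (Fin p) ℝ :=
  Matrix.of fun a h =>
    fderiv ℝ (fun b => D.gbar X Y n b ω a) β (EuclideanSpace.single h 1)

/-- `b` minimizes `Q_n` over the points of `Θ` at which `Q_n` is defined. -/
def IsGMMEstimate (Θ : Set (EuclideanSpace ℝ (Fin p))) (n : ℕ) (ω : Ω)
    (b : EuclideanSpace ℝ (Fin p)) : Prop :=
  b ∈ Θ ∧ IsUnit (D.Sig X Y n b ω).det ∧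
    ∀ β ∈ Θ, IsUnit (D.Sig X Y n β ω).det → D.Q X Y n b ω ≤ D.Q X Y n β ω

variable [MeasurableSpace Ω] (P : Measure Ω) (β₀ : EuclideanSpace ℝ (Fin p))

/-- `Σ₁ = E{S(β₀) S(β₀)ᵀ}`. -/
def Sigma1 : Matrix (Fin L × Fin p) (Fin L × Fin p) ℝ :=
  Matrix.of fun a b => ∫ ω, D.qif β₀ (X 0 ω) (Y 0 ω) a * D.qif β₀ (X 0 ω) (Y 0 ω) b ∂P

/-- `Σ₂ = E{Ψ(β₀) Ψ(β₀)ᵀ}`. -/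
def Sigma2 : Matrix (Fin K × Fin q) (Fin K × Fin q) ℝ :=
  Matrix.of fun a b => ∫ ω, D.aux β₀ (X 0 ω) a * D.aux β₀ (X 0 ω) b ∂P

/-- `B₁`, with `((l, m), h)` entry `-E{∑_{j,k} ∂_m μ_j w^{(l)}_{jk} ∂_h μ_k}` at `β₀`. -/
def B1 : Matrix (Fin L × Fin p) (Fin p) ℝ :=
  Matrix.of fun a h => ∫ ω, -(∑ j, ∑ k, D.muDot β₀ (X 0 ω) j a.2 *
    D.W a.1 β₀ (X 0 ω) j k * D.muDot β₀ (X 0 ω) k h) ∂P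

open Classical in
/-- `B₂`, with `((k, j), h)` entry `E{I(X ∈ Ω_k) ∂_h μ_j}` at `β₀`. -/
def B2 : Matrix (Fin K × Fin q) (Fin p) ℝ :=
  Matrix.of fun a h =>
    ∫ ω, (if X 0 ω ∈ D.grp a.1 then D.muDot β₀ (X 0 ω) a.2 h else 0) ∂P

/-- The limiting covariance matrix `(B₁ᵀ Σ₁⁻¹ B₁ + B₂ᵀ Σ₂⁻¹ B₂)⁻¹`. -/
def asympCov : Matrix (Fin p) (Fin p) ℝ :=
  ((D.B1 X P β₀)ᵀ * (D.Sigma1 X Y P β₀)⁻¹ * D.B1 X P β₀ +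
    (D.B2 X P β₀)ᵀ * (D.Sigma2 X P β₀)⁻¹ * D.B2 X P β₀)⁻¹

/-- The known functions and matrices are admissible: the scale and variance function are positive,
the inverse link is continuously differentiable, linear predictors (for covariates in `𝒳` and
parameters in `V`) lie in the range of the link, the basis matrices represent the inverse of a
nonsingular working correlation matrix, and the subgroups form a partition of `𝒳`. -/
structure Admissible (𝒳 : Set (Fin q → Fin p → ℝ)) (V : Set (EuclideanSpace ℝ (Fin p))) :
    Prop where
  scale_pos : 0 < D.ψ
  v_measurable : Measurable D.v
  v_pos : ∀ m ∈ D.link.source, 0 < D.v m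
  link_smooth : ContDiffOn ℝ 1 D.link.symm D.link.target
  predictor_mem : ∀ x ∈ 𝒳, ∀ β ∈ V, ∀ j, ∑ k, x j k * β k ∈ D.link.target
  working_corr : ∃ (α : Fin L → ℝ) (R : Matrix (Fin q) (Fin q) ℝ),
    R.PosDef ∧ (∀ j, R j j = 1) ∧ R⁻¹ = ∑ l, α l • D.M l
  grp_measurable : ∀ k, MeasurableSet (D.grp k)
  grp_disjoint : Pairwise fun k k' => Disjoint (D.grp k) (D.grp k')
  grp_cover : ⋃ k, D.grp k = 𝒳

/-- The subjects `(X_i, Y_i)` are an i.i.d. sample from the marginal model with true parameter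
`β₀`, and the subgroup means of the response are the known vectors `φ_k`. -/
structure IsSample (𝒳 : Set (Fin q → Fin p → ℝ)) : Prop where
  X_measurable : ∀ i, Measurable (X i)
  Y_measurable : ∀ i, Measurable (Y i)
  indep : iIndepFun (fun i ω => (X i ω, Y i ω)) P
  identDistrib : ∀ i, IdentDistrib (fun ω => (X i ω, Y i ω)) (fun ω => (X 0 ω, Y 0 ω)) P P
  X_mem : ∀ i ω, X i ω ∈ 𝒳
  Y_integrable : ∀ i j, Integrable (fun ω => Y i ω j) P
  mean : ∀ i j, P[fun ω => Y i ω j | MeasurableSpace.comap (X i) inferInstance]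
    =ᵐ[P] fun ω => D.mu β₀ (X i ω) j
  variance : ∀ i j, Var[fun ω => Y i ω j; P |
      MeasurableSpace.comap (fun ω => X i ω j) inferInstance]
    =ᵐ[P] fun ω => D.ψ * D.v (D.mu β₀ (X i ω) j)
  aux_info : ∀ k j, ∫ ω, Y 0 ω j ∂(P[|X 0 ⁻¹' D.grp k]) = D.φ k j

/-- C1: in the compact parameter space `Θ`, with `β₀` in its interior, `β₀` is the unique zero of
the population moment. -/
structure C1 (Θ : Set (EuclideanSpace ℝ (Fin p))) : Prop where
  compact : IsCompact Θ
  mem_interior : β₀ ∈ interior Θ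
  integrable : ∀ β ∈ Θ, ∀ a, Integrable (fun ω => D.moment β (X 0 ω) (Y 0 ω) a) P
  zero : ∀ a, ∫ ω, D.moment β₀ (X 0 ω) (Y 0 ω) a ∂P = 0
  unique : ∀ β ∈ Θ, (∀ a, ∫ ω, D.moment β (X 0 ω) (Y 0 ω) a ∂P = 0) → β = β₀

/-- C2: `Σ₁` and `Σ₂` are finite and positive definite. -/
structure C2 : Prop where
  finite1 : ∀ a b, Integrable
    (fun ω => D.qif β₀ (X 0 ω) (Y 0 ω) a * D.qif β₀ (X 0 ω) (Y 0 ω) b) P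
  finite2 : ∀ a b, Integrable (fun ω => D.aux β₀ (X 0 ω) a * D.aux β₀ (X 0 ω) b) P
  posDef1 : (D.Sigma1 X Y P β₀).PosDef
  posDef2 : (D.Sigma2 X P β₀).PosDef

/-- C3: the marginal variances are twice continuously differentiable in `β`, and bounded with their
derivatives up to the second order, uniformly in `β ∈ V` and in the covariates. -/
structure C3 (𝒳 : Set (Fin q → Fin p → ℝ)) (V : Set (EuclideanSpace ℝ (Fin p))) :
    Prop where
  smooth : ∀ x ∈ 𝒳, ∀ j, ContDiffOn ℝ 2 (fun β => D.A β x j) V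
  bounded : ∃ C : ℝ, ∀ x ∈ 𝒳, ∀ β ∈ V, ∀ j, ∀ r : ℕ, r ≤ 2 →
    ‖iteratedFDeriv ℝ r (fun b => D.A b x j) β‖ ≤ C

/-- C4: `Σ_n` is twice continuously differentiable and converges in probability, uniformly on `V`,
to a limit that is continuous and positive definite at `β₀`. -/
structure C4 (V : Set (EuclideanSpace ℝ (Fin p))) : Prop where
  smooth : ∀ n, ∀ᵐ ω ∂P, ∀ a b, ContDiffOn ℝ 2 (fun β => D.Sig X Y n β ω a b) V
  limit : ∃ Sg : EuclideanSpace ℝ (Fin p) → Matrix (MIdx p q L K) (MIdx p q L K) ℝ,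
    ContinuousAt Sg β₀ ∧ (Sg β₀).PosDef ∧
      SupTendstoZero P V (fun n β ω => mnorm (D.Sig X Y n β ω - Sg β))

/-- C5: `g_n` is twice continuously differentiable; `g_n` and its Jacobian matrix `G_n` converge in
probability, uniformly on `V`, to limits that are continuous at `β₀`; the Jacobian matrix of the
moment function at `β₀` has a finite expectation. -/
structure C5 (V : Set (EuclideanSpace ℝ (Fin p))) : Prop where
  smooth : ∀ n, ∀ᵐ ω ∂P, ∀ a, ContDiffOn ℝ 2 (fun β => D.gbar X Y n β ω a) V
  limit : ∃ g : EuclideanSpace ℝ (Fin p) → MIdx p q L K → ℝ, ContinuousAt g β₀ ∧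
    SupTendstoZero P V (fun n β ω => vnorm (D.gbar X Y n β ω - g β))
  limit_jac : ∃ G : EuclideanSpace ℝ (Fin p) → Matrix (MIdx p q L K) (Fin p) ℝ,
    ContinuousAt G β₀ ∧ SupTendstoZero P V (fun n β ω => mnorm (D.Jac X Y n β ω - G β))
  integrable_jac : ∀ a h, Integrable (fun ω => fderiv ℝ
    (fun b => D.moment b (X 0 ω) (Y 0 ω) a) β₀ (EuclideanSpace.single h 1)) P

end Spec

end MarginalGMM

end

/-!
The objective `Q_n = g_nᵀ Σ_n⁻¹ g_n` is approximated near `β₀` by the least squares form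
`(z + B k)ᵀ Σ⁻¹ (z + B k)`, divided by `n`, in the scaled moment `z = √n g_n(β₀)` and the scaled
error `k = √n (β - β₀)`, where `Σ = diag(Σ₁, Σ₂)` and `B` is the stack of `B₁` and `B₂`. The scaled
error of the estimator is thus `-(Bᵀ Σ⁻¹ B)⁻¹ Bᵀ Σ⁻¹ z`, up to a negligible term, and the central
limit theorem for `z` gives the limit law.

*Approximation.* As in the minimum distance argument for nonsmooth objectives, the values of `Q_n`
at the estimator and at the minimizer of the quadratic form are compared
(`tendsto_minimizer_linearization`), so no derivative of `Σ_n` is needed: only its convergence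
along sequences that tend to `β₀`, and the first-order expansion of `g_n`, which comes from
uniform convergence of the Jacobian matrices (`isLittleO_expansion`). Consistency
(`tendsto_minimizer`) rests on the Cauchy–Schwarz bound `‖g‖⁴ ≤ (gᵀ Σ_n⁻¹ g) (gᵀ Σ_n g)`, since
the limit of `Σ_n` may be singular away from `β₀`. Events of probability tending to one form a
filter `inProb P` on `ℕ × Ω`, and both deterministic lemmas are applied along it.

*Identification of the limits.* The law of large numbers identifies the uniform limit of `g_n`,
and those of `Σ_n` and `G_n` at `β₀`, as expectations. The off-diagonal blocks of `Σ` vanish because the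
residuals have conditional mean zero given the covariates (`integral_qif_mul_aux`). The identity
`E ∂S/∂β = B₁` is `integral_fderiv_qif`: conditionally on the covariates, the difference quotients
of `S` are linear in the residuals up to a term that converges to `-∂μᵀ W ∂μ`, and a pointwise limit
of linear functions of the residuals is linear, hence has mean zero. This needs neither a derivative of `∂μᵀ W` nor
any domination.

*Nonsingularity.* If `B₁ c = 0`, the combination of the `W^{(l)}` that represents the inverse
working covariance matrix shows that `∂μ c = 0` almost surely; then the corresponding combinations
of the entries of `S(β₀)` vanish, against the nonsingularity of `Σ₁` (`injective_B1`).
-/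

namespace MarginalGMM

/-! ### Minimizers of quadratic forms in the moments -/

section Deterministic

variable {ι m E : Type*} [Fintype m]

lemma tendsto_quadForm_inv [DecidableEq m] {l : Filter ι} {u : ι → m → ℝ} {u₀ : m → ℝ}
    {S : ι → Matrix m m ℝ} {T : Matrix m m ℝ} (hT : IsUnit T.det) (hu : Tendsto u l (𝓝 u₀))
    (hS : Tendsto S l (𝓝 T)) :
    Tendsto (fun i => u i ⬝ᵥ ((S i)⁻¹ *ᵥ u i)) l (𝓝 (u₀ ⬝ᵥ (T⁻¹ *ᵥ u₀))) := by
  have hinv : Tendsto (fun i => (S i)⁻¹) l (𝓝 T⁻¹) := by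
    simp only [Matrix.inv_def]
    have hdet : Tendsto (fun i => (S i).det) l (𝓝 T.det) :=
      ((continuous_id.matrix_det).tendsto T).comp hS
    have hadj : Tendsto (fun i => (S i).adjugate) l (𝓝 T.adjugate) :=
      ((continuous_id.matrix_adjugate).tendsto T).comp hS
    simp only [Ring.inverse_eq_inv']
    exact (hdet.inv₀ hT.ne_zero).smul hadj
  have hc : Continuous fun p : (m → ℝ) × Matrix m m ℝ => p.1 ⬝ᵥ (p.2 *ᵥ p.1) := by fun_prop
  exact (hc.tendsto (u₀, T⁻¹)).comp (hu.prodMk_nhds hinv)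

lemma tendsto_quadForm {l : Filter ι} {u : ι → m → ℝ} {u₀ : m → ℝ} {S : ι → Matrix m m ℝ}
    {T : Matrix m m ℝ} (hu : Tendsto u l (𝓝 u₀)) (hS : Tendsto S l (𝓝 T)) :
    Tendsto (fun i => u i ⬝ᵥ (S i *ᵥ u i)) l (𝓝 (u₀ ⬝ᵥ (T *ᵥ u₀))) := by
  have hc : Continuous fun p : (m → ℝ) × Matrix m m ℝ => p.1 ⬝ᵥ (p.2 *ᵥ p.1) := by fun_prop
  exact (hc.tendsto (u₀, T)).comp (hu.prodMk_nhds hS)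

/-- The Cauchy–Schwarz inequality for the form of a nonsingular positive semidefinite `S`. It
bounds the objective `uᵀS⁻¹u` from below without any control on the small eigenvalues of `S`. -/
lemma sq_dotProduct_self_le [DecidableEq m] {S : Matrix m m ℝ} (hS : S.PosSemidef)
    (hdet : IsUnit S.det) (u : m → ℝ) : (u ⬝ᵥ u) ^ 2 ≤ (u ⬝ᵥ (S⁻¹ *ᵥ u)) * (u ⬝ᵥ (S *ᵥ u)) := by
  set w := S⁻¹ *ᵥ u with hw
  have hSw : S *ᵥ w = u := by
    rw [hw, Matrix.mulVec_mulVec, Matrix.mul_nonsing_inv _ hdet, Matrix.one_mulVec]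
  have hT : Sᵀ = S := by simpa using hS.1.eq
  have hsymm : w ⬝ᵥ (S *ᵥ u) = u ⬝ᵥ u := by
    rw [Matrix.dotProduct_mulVec, ← Matrix.mulVec_transpose, hT, hSw]
  have key : ∀ t : ℝ, 0 ≤ (u ⬝ᵥ (S *ᵥ u)) * (t * t) + (-2 * (u ⬝ᵥ u)) * t + u ⬝ᵥ w := by
    intro t
    have h := hS.dotProduct_mulVec_nonneg (t • u - w)
    simp only [star_trivial, Matrix.mulVec_sub, Matrix.mulVec_smul, hSw, dotProduct_sub,
      sub_dotProduct, smul_dotProduct, dotProduct_smul, smul_eq_mul, hsymm] at h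
    rw [dotProduct_comm w u] at h
    linarith
  have := discrim_le_zero key
  simp only [discrim] at this
  linarith

/-- Consistency of the minimizer: a compactness argument along ultrafilters. The limit `S₀` of the
weight matrices may be singular away from `β₀`. -/
lemma tendsto_minimizer [DecidableEq m] [PseudoMetricSpace E] {l : Filter ι} {Θ : Set E}
    (hΘ : IsCompact Θ) {β₀ : E} (hβ₀ : β₀ ∈ Θ)
    {g : ι → E → m → ℝ} {g₀ : E → m → ℝ} {S : ι → E → Matrix m m ℝ} {S₀ : E → Matrix m m ℝ}
    (hg : TendstoUniformlyOn g g₀ l Θ) (hg₀ : ContinuousOn g₀ Θ)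
    (hSu : ∀ b : ι → E, ∀ c ∈ Θ, ∀ l' ≤ l, Tendsto b l' (𝓝[Θ] c) →
      Tendsto (fun i => S i (b i)) l' (𝓝 (S₀ c)))
    (hzero : g₀ β₀ = 0) (huniq : ∀ β ∈ Θ, g₀ β = 0 → β = β₀)
    (hdet : IsUnit (S₀ β₀).det) (hpsd : ∀ i β, (S i β).PosSemidef) {b : ι → E}
    (hb : ∀ᶠ i in l, b i ∈ Θ ∧ IsUnit (S i (b i)).det ∧ ∀ β ∈ Θ, IsUnit (S i β).det →
      g i (b i) ⬝ᵥ ((S i (b i))⁻¹ *ᵥ g i (b i)) ≤ g i β ⬝ᵥ ((S i β)⁻¹ *ᵥ g i β)) :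
    Tendsto b l (𝓝 β₀) := by
  rw [tendsto_iff_ultrafilter]
  intro U hU
  have hbU : ∀ᶠ i in (U : Filter ι), _ := hU hb
  obtain ⟨c, hcΘ, hc⟩ := hΘ.ultrafilter_le_nhds (U.map b) (by
    rw [le_principal_iff]
    exact hbU.mono fun i hi => hi.1)
  have hbc : Tendsto b U (𝓝[Θ] c) :=
    tendsto_nhdsWithin_iff.2 ⟨hc, hbU.mono fun i hi => hi.1⟩
  have hgU : TendstoUniformlyOn g g₀ U Θ := fun s hs => hU (hg s hs)
  have hgc : Tendsto (fun i => g i (b i)) U (𝓝 (g₀ c)) :=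
    hgU.tendsto_comp (hg₀ c hcΘ) hbc
  have hSc := hSu b c hcΘ U hU hbc
  have h0 : Tendsto (fun _ : ι => β₀) U (𝓝[Θ] β₀) :=
    tendsto_nhdsWithin_iff.2 ⟨tendsto_const_nhds, Eventually.of_forall fun _ => hβ₀⟩
  have hg0 : Tendsto (fun i => g i β₀) U (𝓝 (g₀ β₀)) := hgU.tendsto_comp (hg₀ β₀ hβ₀) h0
  have hS0 := hSu (fun _ => β₀) β₀ hβ₀ U hU h0
  have hQ0 := tendsto_quadForm_inv hdet hg0 hS0
  have hd0 : ∀ᶠ i in (U : Filter ι), IsUnit (S i β₀).det := by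
    have : Tendsto (fun i => (S i β₀).det) U (𝓝 (S₀ β₀).det) :=
      ((continuous_id.matrix_det).tendsto _).comp hS0
    exact (this.eventually_ne hdet.ne_zero).mono fun i hi => isUnit_iff_ne_zero.2 hi
  have hprod := hQ0.mul (tendsto_quadForm hgc hSc)
  have hsq : Tendsto (fun i => (g i (b i) ⬝ᵥ g i (b i)) ^ 2) U (𝓝 ((g₀ c ⬝ᵥ g₀ c) ^ 2)) := by
    have hcont : Continuous fun u : m → ℝ => (u ⬝ᵥ u) ^ 2 := by fun_prop
    exact (hcont.tendsto _).comp hgc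
  -- `‖g i (b i)‖⁴` is at most the objective at `b i`, hence at `β₀`, times a convergent factor
  have hle : (g₀ c ⬝ᵥ g₀ c) ^ 2 ≤ 0 := by
    refine (le_of_tendsto_of_tendsto hsq hprod ?_).trans (by simp [hzero])
    filter_upwards [hbU, hd0] with i hi hi0
    refine (sq_dotProduct_self_le (hpsd _ _) hi.2.1 _).trans ?_
    refine mul_le_mul_of_nonneg_right (hi.2.2 β₀ hβ₀ hi0) ?_
    simpa using (hpsd i (b i)).dotProduct_mulVec_nonneg (g i (b i))
  have hgz : g₀ c = 0 := by
    have h1 : (g₀ c ⬝ᵥ g₀ c) ^ 2 = 0 := le_antisymm hle (sq_nonneg _)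
    exact dotProduct_self_eq_zero.1 (pow_eq_zero_iff two_ne_zero |>.1 h1)
  rw [← huniq c hcΘ hgz]
  exact hc

/-- Asymptotic linearity of the minimizer: a quadratic approximation to the objective, which
involves no derivative of the weight matrices `S i`. By `hH`, `H z` solves the least squares problem
of `z` on the range of `B`, for the form of `T⁻¹`. -/
lemma tendsto_minimizer_linearization [DecidableEq m] [NormedAddCommGroup E]
    [NormedSpace ℝ E] [FiniteDimensional ℝ E] {l : Filter ι}
    {Θ : Set E} {β₀ : E} (hΘ : Θ ∈ 𝓝 β₀)
    {g : ι → E → m → ℝ} {S : ι → E → Matrix m m ℝ} {T : Matrix m m ℝ} (hT : T.PosDef)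
    {B : E →L[ℝ] (m → ℝ)} (hB : Function.Injective B) {H : (m → ℝ) →L[ℝ] E}
    (hH : ∀ z k, B k ⬝ᵥ (T⁻¹ *ᵥ (z - B (H z))) = 0)
    (hexp : ∀ b : ι → E, ∀ l' ≤ l, Tendsto b l' (𝓝 β₀) →
      (fun i => g i (b i) - g i β₀ - B (b i - β₀)) =o[l'] fun i => b i - β₀)
    (hSu : ∀ b : ι → E, ∀ l' ≤ l, Tendsto b l' (𝓝 β₀) → Tendsto (fun i => S i (b i)) l' (𝓝 T))
    {r : ι → ℝ} (hr : Tendsto r l atTop) {M : ℝ} (hZ : ∀ᶠ i in l, ‖r i • g i β₀‖ ≤ M)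
    {b : ι → E} (hb : Tendsto b l (𝓝 β₀))
    (hmin : ∀ᶠ i in l, ∀ β ∈ Θ, IsUnit (S i β).det →
      g i (b i) ⬝ᵥ ((S i (b i))⁻¹ *ᵥ g i (b i)) ≤ g i β ⬝ᵥ ((S i β)⁻¹ *ᵥ g i β)) :
    Tendsto (fun i => r i • (b i - β₀) + H (r i • g i β₀)) l (𝓝 0) := by
  have hTdet : IsUnit T.det := (Matrix.isUnit_iff_isUnit_det _).1 hT.isUnit
  have hTinv := hT.inv
  rw [tendsto_iff_ultrafilter]
  intro U hU
  have hrU : Tendsto r U atTop := hr.mono_left hU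
  have hbU : Tendsto b U (𝓝 β₀) := hb.mono_left hU
  have hr0 : ∀ᶠ i in (U : Filter ι), 0 < r i := hrU.eventually_gt_atTop 0
  -- the scaled moments at `β₀` converge along the ultrafilter
  obtain ⟨z, -, hz⟩ := (isCompact_closedBall (0 : m → ℝ) M).ultrafilter_le_nhds
    (U.map fun i => r i • g i β₀) (by
      rw [le_principal_iff]
      exact (show ∀ᶠ i in (U : Filter ι), _ from hU hZ).mono fun i hi => by simpa using hi)
  have hz : Tendsto (fun i => r i • g i β₀) U (𝓝 z) := hz
  have hscale : ∀ (c : ι → E) (s : ι → ℝ) (y : m → ℝ) (k : E), Tendsto c U (𝓝 β₀) →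
      Tendsto (fun i => s i • (c i - β₀)) U (𝓝 k) → Tendsto (fun i => s i • g i β₀) U (𝓝 y) →
      Tendsto (fun i => s i • g i (c i)) U (𝓝 (y + B k)) := by
    intro c s y k hc hk hy
    have ho : (fun i => s i • (g i (c i) - g i β₀ - B (c i - β₀))) =o[(U : Filter ι)]
        fun i => s i • (c i - β₀) :=
      (Asymptotics.isBigO_refl s _).smul_isLittleO (hexp c U hU hc)
    have h0 : Tendsto (fun i => s i • (g i (c i) - g i β₀ - B (c i - β₀))) U (𝓝 0) :=
      (Asymptotics.isLittleO_one_iff ℝ).1 (ho.trans_isBigO (hk.isBigO_one ℝ))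
    have := (hy.add ((B.continuous.tendsto k).comp hk)).add h0
    rw [add_zero] at this
    refine this.congr fun i => ?_
    simp only [Function.comp_apply, map_smul]
    module
  -- the competitor is the minimizer of the quadratic approximation
  set bs : ι → E := fun i => β₀ - (r i)⁻¹ • H (r i • g i β₀) with hbs
  have hHz : Tendsto (fun i => H (r i • g i β₀)) U (𝓝 (H z)) := (H.continuous.tendsto z).comp hz
  have hbs0 : Tendsto bs U (𝓝 β₀) := by
    have := tendsto_const_nhds (x := β₀).sub ((tendsto_inv_atTop_zero.comp hrU).smul hHz)
    rwa [zero_smul, sub_zero] at this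
  have hbsr : Tendsto (fun i => r i • (bs i - β₀)) U (𝓝 (-H z)) := by
    refine hHz.neg.congr' (hr0.mono fun i hi => ?_)
    simp only [hbs, sub_sub_cancel_left, smul_neg, smul_smul, mul_inv_cancel₀ hi.ne', one_smul]
  have hus := hscale bs r z _ hbs0 hbsr hz
  have hQs := tendsto_quadForm_inv hTdet hus (hSu bs U hU hbs0)
  have hds : ∀ᶠ i in (U : Filter ι), IsUnit (S i (bs i)).det := by
    have : Tendsto (fun i => (S i (bs i)).det) U (𝓝 T.det) :=
      ((continuous_id.matrix_det).tendsto _).comp (hSu bs U hU hbs0)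
    exact (this.eventually_ne hTdet.ne_zero).mono fun i hi => isUnit_iff_ne_zero.2 hi
  have hle : ∀ᶠ i in (U : Filter ι), ∀ s : ℝ,
      (s • g i (b i)) ⬝ᵥ ((S i (b i))⁻¹ *ᵥ (s • g i (b i))) ≤
        (s • g i (bs i)) ⬝ᵥ ((S i (bs i))⁻¹ *ᵥ (s • g i (bs i))) := by
    filter_upwards [hU hmin, hds, hbs0 hΘ] with i hi hd hmem s
    have h := hi (bs i) hmem hd
    simp only [smul_dotProduct, Matrix.mulVec_smul, dotProduct_smul, smul_eq_mul, ← mul_assoc]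
    exact mul_le_mul_of_nonneg_left h (mul_self_nonneg s)
  have hSb := hSu b U hU hbU
  -- the scaled estimation error is bounded along the ultrafilter: otherwise the normalized errors
  -- would converge to a unit vector in the kernel of `B`
  have hbdd : ∃ R : ℝ, ∀ᶠ i in (U : Filter ι), ‖r i • (b i - β₀)‖ ≤ R := by
    by_contra hcon
    push Not at hcon
    have htop : Tendsto (fun i => ‖r i • (b i - β₀)‖) U atTop := by
      refine tendsto_atTop.2 fun R => ?_
      exact (hcon R).mono fun i hi => hi.le
    set t : ι → ℝ := fun i => ‖r i • (b i - β₀)‖⁻¹ with ht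
    have ht0 : Tendsto t U (𝓝 0) := tendsto_inv_atTop_zero.comp htop
    have hnorm : ∀ᶠ i in (U : Filter ι), ‖t i • r i • (b i - β₀)‖ = 1 := by
      filter_upwards [htop.eventually_gt_atTop 0] with i hi
      rw [norm_smul, ht, norm_inv, norm_norm, inv_mul_cancel₀ hi.ne']
    obtain ⟨d, hd1, hd⟩ := (isCompact_sphere (0 : E) 1).ultrafilter_le_nhds
      (U.map fun i => t i • r i • (b i - β₀)) (by
        rw [le_principal_iff]
        exact hnorm.mono fun i hi => by simpa using hi)
    have hd : Tendsto (fun i => t i • r i • (b i - β₀)) U (𝓝 d) := hd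
    have hu := hscale b (fun i => t i * r i) 0 d hbU (by simpa [mul_smul] using hd)
      (by simpa [mul_smul] using ht0.smul hz)
    have hQ := tendsto_quadForm_inv hTdet hu hSb
    have hv : Tendsto (fun i => (t i * r i) • g i (bs i)) U (𝓝 0) := by
      simpa [mul_smul] using ht0.smul hus
    have hQv := tendsto_quadForm_inv hTdet hv (hSu bs U hU hbs0)
    have hlim := le_of_tendsto_of_tendsto hQ hQv (hle.mono fun i hi => hi _)
    simp only [zero_add, zero_dotProduct] at hlim
    have hBd : B d = 0 := by
      by_contra hne
      have := hTinv.dotProduct_mulVec_pos hne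
      simp only [star_trivial] at this
      exact absurd hlim this.not_ge
    have hd0 : d = 0 := hB (by rw [hBd, map_zero])
    simp [hd0] at hd1
  obtain ⟨R, hR⟩ := hbdd
  obtain ⟨h, -, hh⟩ := (isCompact_closedBall (0 : E) R).ultrafilter_le_nhds
    (U.map fun i => r i • (b i - β₀)) (by
      rw [le_principal_iff]
      exact hR.mono fun i hi => by simpa using hi)
  have hh : Tendsto (fun i => r i • (b i - β₀)) U (𝓝 h) := hh
  have hu := hscale b r z h hbU hh hz
  have hlim := le_of_tendsto_of_tendsto (tendsto_quadForm_inv hTdet hu hSb) hQs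
    (hle.mono fun i hi => hi _)
  -- Pythagoras: the two limits differ by the form at `B (h + H z)`
  have hsplit : z + B h = (z + B (-H z)) + B (h + H z) := by
    simp only [map_neg, map_add]; abel
  have hTs : (T⁻¹)ᵀ = T⁻¹ := by simpa using hTinv.1.eq
  have hort : B (h + H z) ⬝ᵥ (T⁻¹ *ᵥ (z + B (-H z))) = 0 := by
    simpa [sub_eq_add_neg] using hH z (h + H z)
  have hort' : (z + B (-H z)) ⬝ᵥ (T⁻¹ *ᵥ B (h + H z)) = 0 := by
    rw [Matrix.dotProduct_mulVec, ← Matrix.mulVec_transpose, hTs, dotProduct_comm]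
    exact hort
  rw [hsplit] at hlim
  generalize z + B (-H z) = w at hlim hort hort'
  rw [Matrix.mulVec_add, dotProduct_add, add_dotProduct, add_dotProduct, hort, hort'] at hlim
  have hBk : B (h + H z) = 0 := by
    by_contra hne
    have := hTinv.dotProduct_mulVec_pos hne
    simp only [star_trivial] at this
    linarith
  have hk : h + H z = 0 := hB (by rw [hBk, map_zero])
  rw [← hk]
  exact hh.add hHz

end Deterministic

/-! ### Convergence in probability as a filter -/

section InProbability

variable {Ω : Type*} [MeasurableSpace Ω]

/-- The filter on `ℕ × Ω` of the events that hold with probability tending to one. Convergence in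
probability of a sequence of random variables is convergence along this filter; `P` is read as an
outer measure, so that no measurability is involved. -/
def inProb (P : Measure Ω) : Filter (ℕ × Ω) where
  sets := {s | Tendsto (fun n => P {ω | (n, ω) ∉ s}) atTop (𝓝 0)}
  univ_sets := by simp
  sets_of_superset {s t} hs hst := by
    refine tendsto_of_tendsto_of_tendsto_of_le_of_le tendsto_const_nhds hs (fun _ => zero_le)
      fun n => measure_mono fun ω hω h => hω (hst h)
  inter_sets {s t} hs ht := by
    have := Tendsto.add (show Tendsto _ _ _ from hs) (show Tendsto _ _ _ from ht)
    rw [add_zero] at this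
    refine tendsto_of_tendsto_of_tendsto_of_le_of_le tendsto_const_nhds this (fun _ => zero_le)
      fun n => (measure_mono fun ω hω => ?_).trans (measure_union_le _ _)
    by_contra h
    simp only [Set.mem_union, Set.mem_ofPred_eq, not_or, not_not] at h
    exact hω ⟨h.1, h.2⟩

variable {P : Measure Ω}

lemma eventually_inProb {p : ℕ × Ω → Prop} :
    (∀ᶠ i in inProb P, p i) ↔ Tendsto (fun n => P {ω | ¬ p (n, ω)}) atTop (𝓝 0) := Iff.rfl

lemma eventually_inProb_of_ae {p : ℕ × Ω → Prop} (h : ∀ n, ∀ᵐ ω ∂P, p (n, ω)) :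
    ∀ᶠ i in inProb P, p i := by
  rw [eventually_inProb]
  simp only [fun n => ae_iff.1 (h n), tendsto_const_nhds]

lemma tendsto_fst_inProb : Tendsto Prod.fst (inProb P) atTop := by
  refine tendsto_atTop.2 fun N => eventually_inProb.2 ?_
  refine tendsto_const_nhds.congr' ?_
  filter_upwards [eventually_ge_atTop N] with n hn
  simp [hn]

instance neBot_inProb [IsProbabilityMeasure P] : (inProb P).NeBot := by
  refine ⟨fun h => ?_⟩
  have : (∅ : Set (ℕ × Ω)) ∈ inProb P := h ▸ mem_bot
  have h1 : Tendsto (fun _ : ℕ => P Set.univ) atTop (𝓝 0) := by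
    simpa using (show Tendsto (fun n => P {ω | (n, ω) ∉ (∅ : Set (ℕ × Ω))}) atTop (𝓝 0) from this)
  rw [measure_univ] at h1
  exact one_ne_zero (tendsto_nhds_unique tendsto_const_nhds h1)

lemma tendsto_inProb_of_ae [IsFiniteMeasure P] {f : ℕ → Ω → ℝ} {c : ℝ}
    (hf : ∀ n, AEStronglyMeasurable (f n) P)
    (h : ∀ᵐ ω ∂P, Tendsto (fun n => f n ω) atTop (𝓝 c)) :
    Tendsto (fun i : ℕ × Ω => f i.1 i.2) (inProb P) (𝓝 c) := by
  have h1 := tendstoInMeasure_of_tendsto_ae (g := fun _ => c) hf h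
  rw [tendstoInMeasure_iff_dist] at h1
  rw [Metric.tendsto_nhds]
  intro ε hε
  rw [eventually_inProb]
  simpa only [not_lt] using h1 ε hε

lemma abs_le_vnorm {ι : Type*} [Fintype ι] (u : ι → ℝ) (a : ι) : |u a| ≤ vnorm u := by
  rw [← Real.sqrt_sq_eq_abs]
  exact Real.sqrt_le_sqrt (Finset.single_le_sum (f := fun a => u a ^ 2)
    (fun _ _ => sq_nonneg _) (Finset.mem_univ a))

lemma abs_le_mnorm {ι κ : Type*} [Fintype ι] [Fintype κ] (A : Matrix ι κ ℝ) (a : ι) (b : κ) :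
    |A a b| ≤ mnorm A := by
  rw [← Real.sqrt_sq_eq_abs]
  refine Real.sqrt_le_sqrt ((Finset.single_le_sum (f := fun b => A a b ^ 2)
    (fun _ _ => sq_nonneg _) (Finset.mem_univ b)).trans ?_)
  exact Finset.single_le_sum (f := fun a => ∑ b, A a b ^ 2)
    (fun _ _ => Finset.sum_nonneg fun _ _ => sq_nonneg _) (Finset.mem_univ a)

lemma SupTendstoZero.tendstoUniformlyOn {E : Type*} {V : Set E} {d : ℕ → E → Ω → ℝ}
    (h : SupTendstoZero P V d) {f : ℕ → E → Ω → ℝ} {f₀ : E → ℝ}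
    (hle : ∀ n β ω, |f n β ω - f₀ β| ≤ d n β ω) :
    TendstoUniformlyOn (fun (i : ℕ × Ω) β => f i.1 β i.2) f₀ (inProb P) V := by
  rw [Metric.tendstoUniformlyOn_iff]
  intro ε hε
  rw [eventually_inProb]
  refine tendsto_of_tendsto_of_tendsto_of_le_of_le tendsto_const_nhds (h ε hε) (fun _ => zero_le)
    fun n => measure_mono fun ω hω => ?_
  simp only [Set.mem_ofPred_eq, not_forall, not_lt] at hω ⊢
  obtain ⟨β, hβ, hd⟩ := hω
  refine ⟨β, hβ, (hd.trans ?_).trans (hle n β ω)⟩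
  rw [dist_comm, Real.dist_eq]

end InProbability

/-! ### First-order expansion -/

section Expansion

variable {ι m : Type*} [Fintype m] {p : ℕ}

lemma norm_le_sum_abs_single (φ : EuclideanSpace ℝ (Fin p) →L[ℝ] ℝ) :
    ‖φ‖ ≤ ∑ h, |φ (EuclideanSpace.single h 1)| := by
  refine φ.opNorm_le_bound (Finset.sum_nonneg fun _ _ => abs_nonneg _) fun v => ?_
  have hv : v = ∑ h, v h • EuclideanSpace.single h (1 : ℝ) := by
    simpa using ((EuclideanSpace.basisFun (Fin p) ℝ).sum_repr v).symm
  calc ‖φ v‖ = ‖∑ h, v h • φ (EuclideanSpace.single h 1)‖ := by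
        conv_lhs => rw [hv]
        simp only [map_sum, map_smul]
    _ ≤ ∑ h, ‖v h • φ (EuclideanSpace.single h 1)‖ := norm_sum_le _ _
    _ ≤ ∑ h, |φ (EuclideanSpace.single h 1)| * ‖v‖ := by
        refine Finset.sum_le_sum fun h _ => ?_
        rw [norm_smul, mul_comm, Real.norm_eq_abs]
        exact mul_le_mul_of_nonneg_left (PiLp.norm_apply_le v h) (abs_nonneg _)
    _ = _ := (Finset.sum_mul _ _ _).symm

/-- First-order expansion at `β₀`, uniform in the index: the Jacobian matrices converge uniformly
on `V`, to a limit that is continuous at `β₀`. -/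
lemma isLittleO_expansion {l : Filter ι} {V : Set (EuclideanSpace ℝ (Fin p))}
    {β₀ : EuclideanSpace ℝ (Fin p)} (hV : V ∈ 𝓝 β₀)
    {g : ι → EuclideanSpace ℝ (Fin p) → m → ℝ} {G : EuclideanSpace ℝ (Fin p) → Matrix m (Fin p) ℝ}
    (hG : ContinuousAt G β₀)
    (hdiff : ∀ᶠ i in l, ∀ β ∈ V, ∀ a, DifferentiableAt ℝ (fun b => g i b a) β)
    (hJ : ∀ a h, TendstoUniformlyOn
      (fun i β => fderiv ℝ (fun b => g i b a) β (EuclideanSpace.single h 1))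
      (fun β => G β a h) l V)
    {b : ι → EuclideanSpace ℝ (Fin p)} (hb : Tendsto b l (𝓝 β₀)) :
    (fun i => g i (b i) - g i β₀ - G β₀ *ᵥ (b i - β₀).ofLp) =o[l] fun i => b i - β₀ := by
  rw [Asymptotics.isLittleO_pi]
  intro a
  rw [Asymptotics.isLittleO_iff]
  intro ε hε
  -- `p` errors of size `2 * η` add up to at most `ε`; `p` may be zero
  set η : ℝ := ε / (2 * (p + 1)) with hη
  have hη0 : 0 < η := by positivity
  let φ : EuclideanSpace ℝ (Fin p) →L[ℝ] ℝ := ∑ h, G β₀ a h • EuclideanSpace.proj h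
  have hφ : ∀ v : EuclideanSpace ℝ (Fin p), φ v = (G β₀ *ᵥ v.ofLp) a := by
    intro v
    simp [φ, Matrix.mulVec, dotProduct]
  have hφ1 : ∀ h, φ (EuclideanSpace.single h 1) = G β₀ a h := by
    intro h
    rw [hφ]
    simp [Matrix.mulVec, dotProduct]
  have hGc : ∀ᶠ β in 𝓝 β₀, ∀ h, |G β a h - G β₀ a h| < η := by
    rw [eventually_all]
    intro h
    have hc : ContinuousAt (fun β => G β a h) β₀ :=
      (continuous_apply_apply a h).continuousAt.comp hG
    simpa [Real.dist_eq] using Metric.tendsto_nhds.1 hc η hη0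
  obtain ⟨δ, hδ, hball⟩ := Metric.mem_nhds_iff.1 (inter_mem hV hGc)
  have hJ' : ∀ᶠ i in l, ∀ h, ∀ β ∈ V, |fderiv ℝ (fun b => g i b a) β (EuclideanSpace.single h 1) -
      G β a h| < η := by
    rw [eventually_all]
    intro h
    have := Metric.tendstoUniformlyOn_iff.1 (hJ a h) η hη0
    simpa [Real.dist_eq, abs_sub_comm] using this
  filter_upwards [hdiff, hJ', Metric.tendsto_nhds.1 hb δ hδ] with i hd hj hbi
  have key := (convex_ball β₀ δ).norm_image_sub_le_of_norm_fderiv_le' (𝕜 := ℝ)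
    (f := fun b => g i b a) (φ := φ) (C := ε) (x := β₀) (y := b i)
    (fun x hx => hd x (hball hx).1 a) (fun x hx => ?_) (Metric.mem_ball_self hδ) hbi
  · rw [hφ] at key
    simpa using key
  · refine (norm_le_sum_abs_single _).trans ?_
    calc ∑ h, |(fderiv ℝ (fun b => g i b a) x - φ) (EuclideanSpace.single h 1)|
        ≤ ∑ _h : Fin p, (η + η) := by
          refine Finset.sum_le_sum fun h _ => ?_
          rw [_root_.sub_apply, hφ1]
          exact (abs_sub_le _ (G x a h) _).trans
            (add_le_add (hj h x (hball hx).1).le ((hball hx).2 h).le)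
      _ = p / (p + 1) * ε := by
          simp only [Finset.sum_const, Finset.card_univ, Fintype.card_fin, nsmul_eq_mul, hη]
          field_simp
          ring
      _ ≤ ε := by
          refine mul_le_of_le_one_left hε.le ((div_le_one (by positivity)).2 (by linarith))

end Expansion

/-! ### The marginal model: smoothness, measurability and sample means -/

/-- The mean functions are measurable only on the covariate space, as the inverse link takes
arbitrary values off its domain. They are replaced by measurable extensions. -/
lemma exists_measurable_extend_prod {α β : Type*} [MeasurableSpace α] [MeasurableSpace β]
    {s : Set α} (hs : MeasurableSet s) {f : α → β → ℝ}
    (hf : Measurable fun z : s × β => f z.1 z.2) :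
    ∃ F : α × β → ℝ, Measurable F ∧ ∀ x ∈ s, ∀ y, F (x, y) = f x y := by
  have he : MeasurableEmbedding (Prod.map (Subtype.val : s → α) (id : β → β)) :=
    (MeasurableEmbedding.subtype_coe hs).prodMap MeasurableEmbedding.id
  obtain ⟨F, hF, h⟩ := he.exists_measurable_extend hf fun _ => ⟨0⟩
  exact ⟨F, hF, fun x hx y => congrFun h (⟨x, hx⟩, y)⟩

namespace Spec

variable {p q L K : ℕ} {D : Spec p q L K} {𝒳 : Set (Fin q → Fin p → ℝ)}
  {V : Set (EuclideanSpace ℝ (Fin p))} {β β₀ : EuclideanSpace ℝ (Fin p)}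

/-- The linear predictor `x_jᵀ β`, as a continuous linear function of `β`. -/
noncomputable def predictor (x : Fin q → Fin p → ℝ) (j : Fin q) :
    EuclideanSpace ℝ (Fin p) →L[ℝ] ℝ :=
  ∑ k, x j k • EuclideanSpace.proj k

lemma predictor_apply (x : Fin q → Fin p → ℝ) (j : Fin q) (β : EuclideanSpace ℝ (Fin p)) :
    predictor x j β = ∑ k, x j k * β k := by
  simp [predictor]

lemma mu_eq (D : Spec p q L K) (β : EuclideanSpace ℝ (Fin p)) (x : Fin q → Fin p → ℝ)
    (j : Fin q) : D.mu β x j = D.link.symm (predictor x j β) := by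
  rw [mu, predictor_apply]

lemma Admissible.predictor_mem_target (hD : D.Admissible 𝒳 V) {x : Fin q → Fin p → ℝ}
    (hx : x ∈ 𝒳) (hβ : β ∈ V) (j : Fin q) : predictor x j β ∈ D.link.target := by
  rw [predictor_apply]
  exact hD.predictor_mem x hx β hβ j

lemma Admissible.A_pos (hD : D.Admissible 𝒳 V) {x : Fin q → Fin p → ℝ}
    (hx : x ∈ 𝒳) (hβ : β ∈ V) (j : Fin q) : 0 < D.A β x j := by
  refine mul_pos hD.scale_pos (hD.v_pos _ ?_)
  rw [mu_eq]
  exact D.link.map_target (hD.predictor_mem_target hx hβ j)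

lemma Admissible.hasFDerivAt_mu (hD : D.Admissible 𝒳 V) {x : Fin q → Fin p → ℝ}
    (hx : x ∈ 𝒳) (hβ : β ∈ V) (j : Fin q) :
    HasFDerivAt (fun b => D.mu b x j)
      (deriv D.link.symm (predictor x j β) • predictor x j) β := by
  have ht := hD.predictor_mem_target hx hβ j
  have hd : DifferentiableAt ℝ D.link.symm (predictor x j β) :=
    ((hD.link_smooth.differentiableOn one_ne_zero) _ ht).differentiableAt
      (D.link.open_target.mem_nhds ht)
  have := hd.hasDerivAt.comp_hasFDerivAt β (predictor x j).hasFDerivAt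
  refine this.congr_of_eventuallyEq (Eventually.of_forall fun b => ?_)
  simp [mu_eq]

lemma Admissible.muDot_eq (hD : D.Admissible 𝒳 V) {x : Fin q → Fin p → ℝ}
    (hx : x ∈ 𝒳) (hβ : β ∈ V) (j : Fin q) (k : Fin p) :
    D.muDot β x j k = deriv D.link.symm (predictor x j β) * x j k := by
  rw [muDot, Matrix.of_apply, (hD.hasFDerivAt_mu hx hβ j).fderiv]
  simp [predictor_apply]

lemma Admissible.continuousAt_muDot (hD : D.Admissible 𝒳 V) (hV : IsOpen V)
    {x : Fin q → Fin p → ℝ} (hx : x ∈ 𝒳) (hβ : β ∈ V) (j : Fin q) (k : Fin p) :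
    ContinuousAt (fun b => D.muDot b x j k) β := by
  have ht := hD.predictor_mem_target hx hβ j
  have hc : ContinuousAt (deriv D.link.symm) (predictor x j β) :=
    ((hD.link_smooth.continuousOn_deriv_of_isOpen D.link.open_target le_rfl) _ ht).continuousAt
      (D.link.open_target.mem_nhds ht)
  have h2 : ContinuousAt (fun b => deriv D.link.symm (predictor x j b) * x j k) β :=
    (ContinuousAt.comp (f := fun b => predictor x j b) hc
      (predictor x j).continuous.continuousAt).mul continuousAt_const
  refine h2.congr ?_
  filter_upwards [hV.mem_nhds hβ] with b hb
  rw [hD.muDot_eq hx hb]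

lemma W_apply (D : Spec p q L K) (l : Fin L) (β : EuclideanSpace ℝ (Fin p))
    (x : Fin q → Fin p → ℝ) (i j : Fin q) :
    D.W l β x i j = (√(D.A β x i))⁻¹ * D.M l i j * (√(D.A β x j))⁻¹ := by
  simp [W, Matrix.mul_diagonal, Matrix.diagonal_mul]

/-- The entries of `∂μᵀ W^{(l)}`, the coefficients of the residuals `y - μ` in `S`. -/
noncomputable def qifCoef (D : Spec p q L K) (β : EuclideanSpace ℝ (Fin p))
    (x : Fin q → Fin p → ℝ) (a : Fin L × Fin p) (j : Fin q) : ℝ :=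
  ∑ i, D.muDot β x i a.2 * D.W a.1 β x i j

lemma qif_eq (D : Spec p q L K) (β : EuclideanSpace ℝ (Fin p)) (x : Fin q → Fin p → ℝ)
    (y : Fin q → ℝ) (a : Fin L × Fin p) :
    D.qif β x y a = ∑ j, D.qifCoef β x a j * (y j - D.mu β x j) := by
  simp only [qif, qifCoef, Matrix.mulVec, dotProduct, Matrix.transpose_apply, Pi.sub_apply,
    Finset.sum_mul, Finset.mul_sum]
  rw [Finset.sum_comm]
  simp only [mul_assoc]

lemma continuousAt_qifCoef (hD : D.Admissible 𝒳 V) (h3 : D.C3 𝒳 V) (hV : IsOpen V)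
    {x : Fin q → Fin p → ℝ} (hx : x ∈ 𝒳) (hβ : β ∈ V) (a : Fin L × Fin p) (j : Fin q) :
    ContinuousAt (fun b => D.qifCoef b x a j) β := by
  have hA : ∀ j, ContinuousAt (fun b => (√(D.A b x j))⁻¹) β := fun j =>
    (((h3.smooth x hx j).continuousOn.continuousAt (hV.mem_nhds hβ)).sqrt).inv₀
      (Real.sqrt_pos.2 (hD.A_pos hx hβ j)).ne'
  simp only [qifCoef, W_apply]
  refine tendsto_finsetSum _ fun i _ => ?_
  exact (hD.continuousAt_muDot hV hx hβ i a.2).mul (((hA i).mul continuousAt_const).mul (hA j))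

section Measurability

lemma Admissible.measurableSet_covariates (hD : D.Admissible 𝒳 V) : MeasurableSet 𝒳 := by
  rw [← hD.grp_cover]
  exact MeasurableSet.iUnion hD.grp_measurable

@[fun_prop]
lemma measurable_predictor (β : EuclideanSpace ℝ (Fin p)) (j : Fin q) :
    Measurable fun x : Fin q → Fin p → ℝ => predictor x j β := by
  simp only [predictor_apply]
  fun_prop

lemma Admissible.measurable_mu (hD : D.Admissible 𝒳 V) (hβ : β ∈ V) (j : Fin q) :
    Measurable fun x : 𝒳 => D.mu β x j := by
  have hc : Continuous (D.link.target.domRestrict D.link.symm) :=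
    continuousOn_iff_continuous_domRestrict.1 D.link.symm.continuousOn
  have hm : Measurable fun x : 𝒳 =>
      (⟨predictor x.1 j β, hD.predictor_mem_target x.2 hβ j⟩ : D.link.target) :=
    ((measurable_predictor β j).comp measurable_subtype_coe).subtype_mk
  convert hc.measurable.comp hm using 2 with x
  simp [mu_eq]

lemma Admissible.measurable_muDot (hD : D.Admissible 𝒳 V) (hβ : β ∈ V) (j : Fin q) (k : Fin p) :
    Measurable fun x : 𝒳 => D.muDot β x j k := by
  have h : (fun x : 𝒳 => D.muDot β x j k) =
      fun x : 𝒳 => deriv D.link.symm (predictor x.1 j β) * x.1 j k :=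
    funext fun x => hD.muDot_eq x.2 hβ j k
  rw [h]
  have hx : Measurable fun x : Fin q → Fin p → ℝ => x j k :=
    (measurable_pi_apply k).comp (measurable_pi_apply j)
  exact ((measurable_deriv D.link.symm).comp
    ((measurable_predictor β j).comp measurable_subtype_coe)).mul (hx.comp measurable_subtype_coe)

lemma Admissible.measurable_qifCoef (hD : D.Admissible 𝒳 V) (hβ : β ∈ V) (a : Fin L × Fin p)
    (j : Fin q) : Measurable fun x : 𝒳 => D.qifCoef β x a j := by
  have hA : ∀ j, Measurable fun x : 𝒳 => D.A β x j := fun j =>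
    (hD.v_measurable.comp (hD.measurable_mu hβ j)).const_mul _
  have hm := hD.measurable_muDot hβ
  simp only [qifCoef, W_apply]
  fun_prop

lemma Admissible.measurable_aux (hD : D.Admissible 𝒳 V) (hβ : β ∈ V) (a : Fin K × Fin q) :
    Measurable fun x : 𝒳 => D.aux β x a :=
  Measurable.ite (measurable_subtype_coe (hD.grp_measurable a.1))
    ((hD.measurable_mu hβ a.2).sub_const _) measurable_const

lemma Admissible.measurable_moment (hD : D.Admissible 𝒳 V) (hβ : β ∈ V) (a : MIdx p q L K) :
    Measurable fun z : 𝒳 × (Fin q → ℝ) => D.moment β z.1 z.2 a := by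
  rcases a with a | a
  · simp only [moment, Sum.elim_inl, qif_eq]
    refine Finset.measurable_sum _ fun j _ => ?_
    exact ((hD.measurable_qifCoef hβ a j).comp measurable_fst).mul
      (((measurable_pi_apply j).comp measurable_snd).sub
        ((hD.measurable_mu hβ j).comp measurable_fst))
  · simp only [moment, Sum.elim_inr]
    exact (hD.measurable_aux hβ a).comp measurable_fst

end Measurability

section Derivatives

open Classical in
lemma fderiv_aux (D : Spec p q L K) (β : EuclideanSpace ℝ (Fin p))
    (x : Fin q → Fin p → ℝ) (a : Fin K × Fin q)
    (h : Fin p) : fderiv ℝ (fun b => D.aux b x a) β (EuclideanSpace.single h 1) =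
      if x ∈ D.grp a.1 then D.muDot β x a.2 h else 0 := by
  by_cases hg : x ∈ D.grp a.1
  · simp [aux, hg, muDot, fderiv_sub_const]
  · simp [aux, hg]

end Derivatives

section Sample

variable {Ω : Type*} [MeasurableSpace Ω] {P : Measure Ω} {X : ℕ → Ω → Fin q → Fin p → ℝ}
  {Y : ℕ → Ω → Fin q → ℝ}

/-- The individual moments inherit the smoothness of the sample means, of which they are linear
combinations. -/
lemma C5.contDiffOn_moment (h5 : D.C5 X Y P β₀ V) (i : ℕ) :
    ∀ᵐ ω ∂P, ∀ a, ContDiffOn ℝ 2 (fun β => D.moment β (X i ω) (Y i ω) a) V := by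
  have hn : ∀ (n : ℕ) ω β a, (n : ℝ) * D.gbar X Y n β ω a =
      ∑ i ∈ Finset.range n, D.moment β (X i ω) (Y i ω) a := by
    intro n ω β a
    rcases eq_or_ne n 0 with rfl | h
    · simp
    · have : (n : ℝ) ≠ 0 := by exact_mod_cast h
      simp [gbar, Finset.sum_apply, this]
  filter_upwards [h5.smooth i, h5.smooth (i + 1)] with ω h1 h2 a
  have h := (contDiffOn_const (c := ((i + 1 : ℕ) : ℝ))).mul (h2 a) |>.sub
    ((contDiffOn_const (c := (i : ℝ))).mul (h1 a))
  refine h.congr fun β _ => ?_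
  rw [hn, hn, Finset.sum_range_succ]
  ring

lemma C5.differentiableAt_moment (h5 : D.C5 X Y P β₀ V) (hV : IsOpen V) (i : ℕ) :
    ∀ᵐ ω ∂P, ∀ a, ∀ β ∈ V,
      DifferentiableAt ℝ (fun b => D.moment b (X i ω) (Y i ω) a) β := by
  filter_upwards [h5.contDiffOn_moment i] with ω h a β hβ
  exact ((h a).contDiffAt (hV.mem_nhds hβ)).differentiableAt two_ne_zero

lemma C5.jac_eq (h5 : D.C5 X Y P β₀ V) (hV : IsOpen V) (n : ℕ) :
    ∀ᵐ ω ∂P, ∀ β ∈ V, ∀ a h, D.Jac X Y n β ω a h = (∑ i ∈ Finset.range n,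
      fderiv ℝ (fun b => D.moment b (X i ω) (Y i ω) a) β (EuclideanSpace.single h 1)) / n := by
  filter_upwards [ae_all_iff.2 fun i => h5.differentiableAt_moment hV i] with ω hω β hβ a h
  have h1 : (fun b => D.gbar X Y n b ω a) = fun b =>
      (n : ℝ)⁻¹ • ∑ i ∈ Finset.range n, D.moment b (X i ω) (Y i ω) a := by
    ext b
    simp [gbar, Finset.sum_apply]
  have hsum : HasFDerivAt (fun b => ∑ i ∈ Finset.range n, D.moment b (X i ω) (Y i ω) a)
      (∑ i ∈ Finset.range n, fderiv ℝ (fun b => D.moment b (X i ω) (Y i ω) a) β) β :=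
    HasFDerivAt.fun_sum fun i _ => (hω i a β hβ).hasFDerivAt
  rw [Jac, Matrix.of_apply, h1, (hsum.fun_const_smul _).fderiv]
  simp [div_eq_inv_mul]

/-- Strong law of large numbers for a measurable function of the observations. -/
lemma IsSample.ae_tendsto_mean [IsProbabilityMeasure P] (hS : D.IsSample X Y P β₀ 𝒳)
    {F : (Fin q → Fin p → ℝ) × (Fin q → ℝ) → ℝ} (hF : Measurable F)
    (hint : Integrable (fun ω => F (X 0 ω, Y 0 ω)) P) :
    ∀ᵐ ω ∂P, Tendsto (fun n : ℕ => (∑ i ∈ Finset.range n, F (X i ω, Y i ω)) / n) atTop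
      (𝓝 (∫ ω, F (X 0 ω, Y 0 ω) ∂P)) :=
  strong_law_ae_real (fun i ω => F (X i ω, Y i ω)) hint
    (fun _ _ hij => ((hS.indep.comp (fun _ => F) fun _ => hF).indepFun hij))
    fun i => (hS.identDistrib i).comp hF

lemma IsSample.tendsto_mean [IsProbabilityMeasure P] (hS : D.IsSample X Y P β₀ 𝒳)
    {F : (Fin q → Fin p → ℝ) × (Fin q → ℝ) → ℝ} (hF : Measurable F)
    (hint : Integrable (fun ω => F (X 0 ω, Y 0 ω)) P) :
    Tendsto (fun i : ℕ × Ω => (∑ k ∈ Finset.range i.1, F (X k i.2, Y k i.2)) / i.1)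
      (inProb P) (𝓝 (∫ ω, F (X 0 ω, Y 0 ω) ∂P)) := by
  refine tendsto_inProb_of_ae (f := fun n ω => (∑ k ∈ Finset.range n, F (X k ω, Y k ω)) / n)
    (fun n => ?_) (hS.ae_tendsto_mean hF hint)
  have := fun k => hF.comp ((hS.X_measurable k).prodMk (hS.Y_measurable k))
  exact ((Finset.measurable_fun_sum _ fun k _ => this k).div_const _).aestronglyMeasurable

end Sample

end Spec

/-! ### Conditional means and the derivative of the estimating functions -/

/-- A pointwise limit of linear functions is linear on the subspace on which it exists. The
coefficients `c n` themselves need not converge. -/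
lemma exists_coef_of_tendsto {ι : Type*} [Fintype ι] (c : ℕ → ι → ℝ) :
    ∃ c₀ : ι → ℝ, ∀ (u : ι → ℝ) (z : ℝ), Tendsto (fun n => ∑ j, c n j * u j) atTop (𝓝 z) →
      z = ∑ j, c₀ j * u j := by
  classical
  let U : Submodule ℝ (ι → ℝ) :=
    { carrier := {u | ∃ z, Tendsto (fun n => ∑ j, c n j * u j) atTop (𝓝 z)}
      zero_mem' := ⟨0, by simp⟩
      add_mem' := by
        rintro u v ⟨z, hz⟩ ⟨w, hw⟩
        refine ⟨z + w, (hz.add hw).congr fun n => ?_⟩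
        simp [mul_add, Finset.sum_add_distrib]
      smul_mem' := by
        rintro s u ⟨z, hz⟩
        refine ⟨s * z, (hz.const_mul s).congr fun n => ?_⟩
        simp [Finset.mul_sum, mul_left_comm] }
  have hlim : ∀ u : U, ∃ z, Tendsto (fun n => ∑ j, c n j * u.1 j) atTop (𝓝 z) := fun u => u.2
  choose f hf using hlim
  let φ : U →ₗ[ℝ] ℝ :=
    { toFun := f
      map_add' := fun u v => by
        refine tendsto_nhds_unique (hf (u + v)) (((hf u).add (hf v)).congr fun n => ?_)
        simp [mul_add, Finset.sum_add_distrib]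
      map_smul' := fun s u => by
        refine tendsto_nhds_unique (hf (s • u)) (((hf u).const_mul s).congr fun n => ?_)
        simp [Finset.mul_sum, mul_left_comm] }
  obtain ⟨ψ, hψ⟩ := LinearMap.exists_extend φ
  refine ⟨fun j => ψ (Pi.single j 1), fun u z hz => ?_⟩
  have hu : u ∈ U := ⟨z, hz⟩
  have h1 : z = ψ u := by
    have : ψ u = φ ⟨u, hu⟩ := by rw [← hψ]; rfl
    rw [this]
    exact tendsto_nhds_unique hz (hf ⟨u, hu⟩)
  rw [h1]
  conv_lhs => rw [pi_eq_sum_univ' u]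
  simp [map_sum, mul_comm]

/-- A limit of linear functions of a centered vector is centered, with no domination hypothesis. -/
lemma integral_eq_zero_of_tendsto_linear {ι : Type*} [Fintype ι] {ν : Measure (ι → ℝ)}
    [IsProbabilityMeasure ν] {μ : ι → ℝ} (hint : ∀ j, Integrable (fun y => y j) ν)
    (hmean : ∀ j, ∫ y, y j ∂ν = μ j) {c : ℕ → ι → ℝ} {Z : (ι → ℝ) → ℝ}
    (h : ∀ᵐ y ∂ν, Tendsto (fun n => ∑ j, c n j * (y j - μ j)) atTop (𝓝 (Z y))) :
    Integrable Z ν ∧ ∫ y, Z y ∂ν = 0 := by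
  obtain ⟨c₀, hc₀⟩ := exists_coef_of_tendsto c
  have hZ : Z =ᵐ[ν] fun y => ∑ j, c₀ j * (y j - μ j) := by
    filter_upwards [h] with y hy using hc₀ (fun j => y j - μ j) _ hy
  have hi : ∀ j, Integrable (fun y : ι → ℝ => c₀ j * (y j - μ j)) ν := fun j =>
    ((hint j).sub (integrable_const _)).const_mul _
  refine ⟨(integrable_finsetSum _ fun j _ => hi j).congr hZ.symm, ?_⟩
  rw [integral_congr_ae hZ, integral_finsetSum _ fun j _ => hi j]
  refine Finset.sum_eq_zero fun j _ => ?_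
  rw [integral_const_mul, integral_sub (hint j) (integrable_const _), hmean]
  simp

section Disintegration

variable {Ω α β : Type*} [MeasurableSpace Ω] {P : Measure Ω} [IsProbabilityMeasure P]
  [MeasurableSpace α] [MeasurableSpace β] [StandardBorelSpace β] [Nonempty β]
  {X : Ω → α} {Y : Ω → β}

lemma integral_eq_of_integral_condDistrib (hX : Measurable X) (hY : Measurable Y)
    {F : α × β → ℝ} (hF : Measurable F) (hint : Integrable (fun ω => F (X ω, Y ω)) P) {r : Ω → ℝ}
    (hr : ∀ᵐ ω ∂P, ∫ y, F (X ω, y) ∂condDistrib Y X P (X ω) = r ω) :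
    Integrable r P ∧ ∫ ω, r ω ∂P = ∫ ω, F (X ω, Y ω) ∂P := by
  have h := (condExp_prod_ae_eq_integral_condDistrib hX hY.aemeasurable hF.stronglyMeasurable
    hint).trans hr
  refine ⟨integrable_condExp.congr h, ?_⟩
  rw [← integral_congr_ae h, integral_condExp hX.comap_le]

lemma ae_condDistrib_of_ae (hX : Measurable X) (hY : Measurable Y) {s : Set (α × β)}
    (hs : MeasurableSet s) (h : ∀ᵐ ω ∂P, (X ω, Y ω) ∈ s) :
    ∀ᵐ ω ∂P, ∀ᵐ y ∂condDistrib Y X P (X ω), (X ω, y) ∈ s := by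
  have h1 : ∀ᵐ z ∂(P.map fun ω => (X ω, Y ω)), z ∈ s :=
    (ae_map_iff (hX.prodMk hY).aemeasurable hs).2 h
  rw [← compProd_map_condDistrib hY.aemeasurable] at h1
  exact ae_of_ae_map hX.aemeasurable (Measure.ae_ae_of_ae_compProd h1)

end Disintegration

namespace Spec

variable {p q L K : ℕ} {D : Spec p q L K} {𝒳 : Set (Fin q → Fin p → ℝ)}
  {V Θ : Set (EuclideanSpace ℝ (Fin p))} {β β₀ : EuclideanSpace ℝ (Fin p)}
  {Ω : Type*} [MeasurableSpace Ω] {P : Measure Ω}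
  {X : ℕ → Ω → Fin q → Fin p → ℝ} {Y : ℕ → Ω → Fin q → ℝ}

lemma IsSample.condDistrib_mean [IsProbabilityMeasure P] (hS : D.IsSample X Y P β₀ 𝒳) :
    ∀ᵐ ω ∂P, ∀ j, Integrable (fun y : Fin q → ℝ => y j) (condDistrib (Y 0) (X 0) P (X 0 ω)) ∧
      ∫ y, y j ∂condDistrib (Y 0) (X 0) P (X 0 ω) = D.mu β₀ (X 0 ω) j := by
  rw [ae_all_iff]
  intro j
  have hX := hS.X_measurable 0
  have hY := hS.Y_measurable 0
  have hm : StronglyMeasurable fun z : (Fin q → Fin p → ℝ) × (Fin q → ℝ) => z.2 j :=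
    ((measurable_pi_apply j).comp measurable_snd).stronglyMeasurable
  have hint : Integrable (fun z : (Fin q → Fin p → ℝ) × (Fin q → ℝ) => z.2 j)
      (P.map fun ω => (X 0 ω, Y 0 ω)) :=
    (integrable_map_measure hm.aestronglyMeasurable (hX.prodMk hY).aemeasurable).2
      (hS.Y_integrable 0 j)
  filter_upwards [hint.condDistrib_ae hX.aemeasurable hY.aemeasurable,
    condExp_prod_ae_eq_integral_condDistrib hX hY.aemeasurable hm (hS.Y_integrable 0 j),
    hS.mean 0 j] with ω h1 h2 h3
  exact ⟨h1, h2.symm.trans h3⟩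

lemma C2.memLp_moment (h2 : D.C2 X Y P β₀)
    (hint : ∀ a, Integrable (fun ω => D.moment β₀ (X 0 ω) (Y 0 ω) a) P) (a : MIdx p q L K) :
    MemLp (fun ω => D.moment β₀ (X 0 ω) (Y 0 ω) a) 2 P := by
  rw [memLp_two_iff_integrable_sq (hint a).aestronglyMeasurable]
  rcases a with a | a
  · simpa [moment, sq] using h2.finite1 a a
  · simpa [moment, sq] using h2.finite2 a a

/-- The estimating functions `S(β₀)` are uncorrelated with the auxiliary information `Ψ(β₀)`,
a function of the covariates: the residuals have conditional mean zero. -/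
lemma integral_qif_mul_aux [IsProbabilityMeasure P] (hD : D.Admissible 𝒳 V)
    (hS : D.IsSample X Y P β₀ 𝒳) (hβ₀ : β₀ ∈ V)
    (h2 : D.C2 X Y P β₀) (hint : ∀ a, Integrable (fun ω => D.moment β₀ (X 0 ω) (Y 0 ω) a) P)
    (a : Fin L × Fin p) (b : Fin K × Fin q) :
    ∫ ω, D.qif β₀ (X 0 ω) (Y 0 ω) a * D.aux β₀ (X 0 ω) b ∂P = 0 := by
  have hm : Measurable fun z : 𝒳 × (Fin q → ℝ) =>
      D.moment β₀ z.1 z.2 (Sum.inl a) * D.moment β₀ z.1 z.2 (Sum.inr b) :=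
    (hD.measurable_moment hβ₀ _).mul (hD.measurable_moment hβ₀ _)
  obtain ⟨F, hF, hFeq⟩ := exists_measurable_extend_prod hD.measurableSet_covariates
    (f := fun x y => D.moment β₀ x y (Sum.inl a) * D.moment β₀ x y (Sum.inr b)) hm
  have hFω : ∀ ω, F (X 0 ω, Y 0 ω) = D.qif β₀ (X 0 ω) (Y 0 ω) a * D.aux β₀ (X 0 ω) b :=
    fun ω => hFeq _ (hS.X_mem 0 ω) _
  have hi : Integrable (fun ω => F (X 0 ω, Y 0 ω)) P := by
    simp only [hFω]
    exact (h2.memLp_moment hint (Sum.inl a)).integrable_mul (h2.memLp_moment hint (Sum.inr b))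
  have h := integral_eq_of_integral_condDistrib (hS.X_measurable 0) (hS.Y_measurable 0) hF hi
    (r := fun _ => 0) ?_
  · simpa [hFω] using h.2.symm
  · filter_upwards [hS.condDistrib_mean] with ω hω
    simp only [hFeq _ (hS.X_mem 0 ω), moment, Sum.elim_inl, Sum.elim_inr, qif_eq]
    rw [integral_mul_const, (integral_eq_zero_of_tendsto_linear (fun j => (hω j).1)
      (fun j => (hω j).2) (c := fun _ j => D.qifCoef β₀ (X 0 ω) a j)
      (Eventually.of_forall fun y => tendsto_const_nhds)).2, zero_mul]

/-- A measurable version, common to all subjects, of a partial derivative of the moment function,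
obtained as the limit of measurable difference quotients. -/
lemma exists_measurable_fderiv (hD : D.Admissible 𝒳 V) (hS : D.IsSample X Y P β₀ 𝒳)
    (hV : IsOpen V) (hβ₀ : β₀ ∈ V) (h5 : D.C5 X Y P β₀ V) (a : MIdx p q L K) (h : Fin p) :
    ∃ (c : ℕ → ℝ) (F : (Fin q → Fin p → ℝ) × (Fin q → ℝ) → ℝ)
      (f : ℕ → (Fin q → Fin p → ℝ) × (Fin q → ℝ) → ℝ),
      Tendsto c atTop atTop ∧ Measurable F ∧ (∀ n, Measurable (f n)) ∧
      (∀ n, ∀ x ∈ 𝒳, ∀ y, f n (x, y) =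
        c n * (D.moment (β₀ + (c n)⁻¹ • EuclideanSpace.single h 1) x y a - D.moment β₀ x y a)) ∧
      (∀ᵐ ω ∂P, Tendsto (fun n => f n (X 0 ω, Y 0 ω)) atTop (𝓝 (F (X 0 ω, Y 0 ω)))) ∧
      ∀ i, ∀ᵐ ω ∂P, F (X i ω, Y i ω) =
        fderiv ℝ (fun b => D.moment b (X i ω) (Y i ω) a) β₀ (EuclideanSpace.single h 1) := by
  obtain ⟨δ, hδ, hball⟩ := Metric.isOpen_iff.1 hV β₀ hβ₀
  -- the shift keeps the steps `(c n)⁻¹` below `δ`, so that all points lie in `V`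
  set c : ℕ → ℝ := fun n => n + (δ⁻¹ + 1) with hc
  have hδ' : 0 < δ⁻¹ := inv_pos.2 hδ
  have hcpos : ∀ n, δ⁻¹ < c n := fun n => by
    have : (0 : ℝ) ≤ n := Nat.cast_nonneg n
    simp only [hc]; linarith
  have hctop : Tendsto c atTop atTop :=
    tendsto_atTop_add_const_right _ _ tendsto_natCast_atTop_atTop
  have hmem : ∀ n, β₀ + (c n)⁻¹ • EuclideanSpace.single h (1 : ℝ) ∈ V := by
    intro n
    refine hball ?_
    have h0 : 0 < c n := hδ'.trans (hcpos n)
    simp only [Metric.mem_ball, dist_self_add_left, norm_smul, norm_inv, Real.norm_eq_abs,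
      abs_of_pos h0, PiLp.norm_single, abs_one, mul_one]
    exact inv_lt_of_inv_lt₀ hδ (hcpos n)
  have hex : ∀ n, ∃ f : (Fin q → Fin p → ℝ) × (Fin q → ℝ) → ℝ, Measurable f ∧
      ∀ x ∈ 𝒳, ∀ y, f (x, y) = c n *
        (D.moment (β₀ + (c n)⁻¹ • EuclideanSpace.single h 1) x y a - D.moment β₀ x y a) :=
    fun n => exists_measurable_extend_prod hD.measurableSet_covariates
      (((hD.measurable_moment (hmem n) a).sub (hD.measurable_moment hβ₀ a)).const_mul (c n))
  choose f hfm hfeq using hex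
  have hlim : ∀ i, ∀ᵐ ω ∂P, Tendsto (fun n => f n (X i ω, Y i ω)) atTop
      (𝓝 (fderiv ℝ (fun b => D.moment b (X i ω) (Y i ω) a) β₀ (EuclideanSpace.single h 1))) := by
    intro i
    filter_upwards [h5.differentiableAt_moment hV i] with ω hω
    simp only [hfeq _ _ (hS.X_mem i ω)]
    exact (hω a β₀ hβ₀).hasFDerivAt.lim _ (tendsto_norm_atTop_atTop.comp hctop)
  refine ⟨c, fun z => limsup (fun n => f n z) atTop, f, hctop, Measurable.limsup hfm, hfm, hfeq,
    ?_, fun i => ?_⟩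
  · filter_upwards [hlim 0] with ω hω
    rwa [hω.limsup_eq]
  · filter_upwards [hlim i] with ω hω using hω.limsup_eq

/-- `E{∂S/∂β | X} = -∂μᵀ W ∂μ` at `β₀`: the difference quotients of `S` are, up to a term that
converges to the right-hand side, linear in the residuals. Neither the derivative of `∂μᵀ W` nor
the integrability of the entries of `∂μᵀ W ∂μ` has to be assumed. -/
lemma integral_fderiv_qif [IsProbabilityMeasure P] (hD : D.Admissible 𝒳 V)
    (hS : D.IsSample X Y P β₀ 𝒳)
    (hV : IsOpen V) (hβ₀ : β₀ ∈ V) (h3 : D.C3 𝒳 V) (h5 : D.C5 X Y P β₀ V) (a : Fin L × Fin p)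
    (h : Fin p) :
    Integrable (fun ω => -∑ j, D.qifCoef β₀ (X 0 ω) a j * D.muDot β₀ (X 0 ω) j h) P ∧
    ∫ ω, -∑ j, D.qifCoef β₀ (X 0 ω) a j * D.muDot β₀ (X 0 ω) j h ∂P =
      ∫ ω, fderiv ℝ (fun b => D.moment b (X 0 ω) (Y 0 ω) (Sum.inl a)) β₀
        (EuclideanSpace.single h 1) ∂P := by
  obtain ⟨c, F, f, hc, hF, hf, hfeq, hlim, hFeq⟩ :=
    exists_measurable_fderiv hD hS hV hβ₀ h5 (Sum.inl a) h
  have hX := hS.X_measurable 0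
  have hY := hS.Y_measurable 0
  have hi : Integrable (fun ω => F (X 0 ω, Y 0 ω)) P :=
    (h5.integrable_jac (Sum.inl a) h).congr ((hFeq 0).mono fun ω hω => hω.symm)
  rw [← integral_congr_ae (hFeq 0)]
  refine integral_eq_of_integral_condDistrib hX hY hF hi ?_
  have hconv := ae_condDistrib_of_ae hX hY (measurableSet_tendsto_fun (l := atTop) hf hF) hlim
  filter_upwards [hconv, hS.condDistrib_mean] with ω hω hmean
  set x := X 0 ω with hx
  have hx𝒳 : x ∈ 𝒳 := hS.X_mem 0 ω
  set b : ℕ → EuclideanSpace ℝ (Fin p) := fun n => β₀ + (c n)⁻¹ • EuclideanSpace.single h 1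
    with hb
  have hbt : Tendsto b atTop (𝓝 β₀) := by
    have := (tendsto_const_nhds (x := β₀)).add ((tendsto_inv_atTop_zero.comp hc).smul_const
      (EuclideanSpace.single h (1 : ℝ)))
    rwa [zero_smul, add_zero] at this
  -- the part of the difference quotient that does not involve `y`
  have hdet : Tendsto (fun n => ∑ j, D.qifCoef (b n) x a j * (c n * (D.mu (b n) x j -
      D.mu β₀ x j))) atTop (𝓝 (∑ j, D.qifCoef β₀ x a j * D.muDot β₀ x j h)) := by
    refine tendsto_finsetSum _ fun j _ => ?_
    refine ((continuousAt_qifCoef hD h3 hV hx𝒳 hβ₀ a j).tendsto.comp hbt).mul ?_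
    have hd := (hD.hasFDerivAt_mu hx𝒳 hβ₀ j).differentiableAt.hasFDerivAt
    exact hd.lim (EuclideanSpace.single h 1) (tendsto_norm_atTop_atTop.comp hc)
  set s := ∑ j, D.qifCoef β₀ x a j * D.muDot β₀ x j h with hs
  have hlin : ∀ᵐ y ∂condDistrib (Y 0) (X 0) P x, Tendsto (fun n =>
      ∑ j, (c n * (D.qifCoef (b n) x a j - D.qifCoef β₀ x a j)) * (y j - D.mu β₀ x j)) atTop
      (𝓝 (F (x, y) + s)) := by
    filter_upwards [hω] with y hy
    have hy : Tendsto (fun n => f n (x, y)) atTop (𝓝 (F (x, y))) := hy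
    refine (hy.add hdet).congr fun n => ?_
    rw [hfeq n x hx𝒳]
    simp only [moment, Sum.elim_inl, qif_eq]
    rw [← Finset.sum_sub_distrib, Finset.mul_sum, ← Finset.sum_add_distrib]
    refine Finset.sum_congr rfl fun j _ => ?_
    simp only [hb]
    ring
  obtain ⟨hint, hzero⟩ := integral_eq_zero_of_tendsto_linear (fun j => (hmean j).1)
    (fun j => (hmean j).2) hlin
  have h1 : ∫ y, F (x, y) ∂condDistrib (Y 0) (X 0) P x =
      ∫ y, (F (x, y) + s) - s ∂condDistrib (Y 0) (X 0) P x := by simp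
  rw [h1, integral_sub hint (integrable_const _), hzero]
  simp

end Spec

/-! ### Population limits -/

namespace Spec

section PopulationLimits

variable {p q L K : ℕ} {D : Spec p q L K} {𝒳 : Set (Fin q → Fin p → ℝ)}
  {V Θ : Set (EuclideanSpace ℝ (Fin p))} {β β₀ : EuclideanSpace ℝ (Fin p)}
  {Ω : Type*} [MeasurableSpace Ω] {P : Measure Ω} [IsProbabilityMeasure P]
  {X : ℕ → Ω → Fin q → Fin p → ℝ} {Y : ℕ → Ω → Fin q → ℝ}

/-- The block diagonal matrix of `Σ₁` and `Σ₂`, the covariance matrix of the moment function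
at `β₀`. -/
noncomputable def momentCov (D : Spec p q L K) (X : ℕ → Ω → Fin q → Fin p → ℝ)
    (Y : ℕ → Ω → Fin q → ℝ) (P : Measure Ω) (β₀ : EuclideanSpace ℝ (Fin p)) :
    Matrix (MIdx p q L K) (MIdx p q L K) ℝ :=
  Matrix.fromBlocks (D.Sigma1 X Y P β₀) 0 0 (D.Sigma2 X P β₀)

/-- The stack of `B₁` and `B₂`, the expected Jacobian matrix of the moment function at `β₀`. -/
noncomputable def momentJac (D : Spec p q L K) (X : ℕ → Ω → Fin q → Fin p → ℝ)
    (P : Measure Ω) (β₀ : EuclideanSpace ℝ (Fin p)) : Matrix (MIdx p q L K) (Fin p) ℝ :=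
  Matrix.fromRows (D.B1 X P β₀) (D.B2 X P β₀)

lemma integral_moment_mul (hD : D.Admissible 𝒳 V) (hS : D.IsSample X Y P β₀ 𝒳) (hβ₀ : β₀ ∈ V)
    (h2 : D.C2 X Y P β₀) (hint : ∀ a, Integrable (fun ω => D.moment β₀ (X 0 ω) (Y 0 ω) a) P)
    (a b : MIdx p q L K) :
    ∫ ω, D.moment β₀ (X 0 ω) (Y 0 ω) a * D.moment β₀ (X 0 ω) (Y 0 ω) b ∂P =
      D.momentCov X Y P β₀ a b := by
  rcases a with a | a <;> rcases b with b | b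
  · simp [moment, momentCov, Sigma1]
  · simp [moment, momentCov, integral_qif_mul_aux hD hS hβ₀ h2 hint a b]
  · simpa [moment, momentCov, mul_comm] using integral_qif_mul_aux hD hS hβ₀ h2 hint b a
  · simp [moment, momentCov, Sigma2]

omit [IsProbabilityMeasure P] in
lemma B1_apply (a : Fin L × Fin p) (h : Fin p) : D.B1 X P β₀ a h =
    ∫ ω, -∑ j, D.qifCoef β₀ (X 0 ω) a j * D.muDot β₀ (X 0 ω) j h ∂P := by
  rw [B1, Matrix.of_apply]
  congr with ω
  simp only [qifCoef, Finset.sum_mul]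
  rw [Finset.sum_comm]

lemma integral_fderiv_moment (hD : D.Admissible 𝒳 V) (hS : D.IsSample X Y P β₀ 𝒳)
    (hV : IsOpen V) (hβ₀ : β₀ ∈ V) (h3 : D.C3 𝒳 V) (h5 : D.C5 X Y P β₀ V) (a : MIdx p q L K)
    (h : Fin p) :
    ∫ ω, fderiv ℝ (fun b => D.moment b (X 0 ω) (Y 0 ω) a) β₀ (EuclideanSpace.single h 1) ∂P =
      D.momentJac X P β₀ a h := by
  rcases a with a | a
  · rw [← (integral_fderiv_qif hD hS hV hβ₀ h3 h5 a h).2]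
    simp [momentJac, B1_apply]
  · simp only [moment, Sum.elim_inr, fderiv_aux, momentJac, B2, Matrix.fromRows_apply_inr,
      Matrix.of_apply]

lemma tendsto_gbar (hD : D.Admissible 𝒳 V) (hS : D.IsSample X Y P β₀ 𝒳) (hβ : β ∈ V)
    (a : MIdx p q L K) (hint : Integrable (fun ω => D.moment β (X 0 ω) (Y 0 ω) a) P) :
    Tendsto (fun i : ℕ × Ω => D.gbar X Y i.1 β i.2 a) (inProb P)
      (𝓝 (∫ ω, D.moment β (X 0 ω) (Y 0 ω) a ∂P)) := by
  obtain ⟨F, hF, hFeq⟩ := exists_measurable_extend_prod hD.measurableSet_covariates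
    (f := fun x y => D.moment β x y a) (hD.measurable_moment hβ a)
  have hFω : ∀ i ω, F (X i ω, Y i ω) = D.moment β (X i ω) (Y i ω) a :=
    fun i ω => hFeq _ (hS.X_mem i ω) _
  have h := hS.tendsto_mean hF (by simpa only [hFω] using hint)
  simp only [hFω] at h
  refine h.congr fun i => ?_
  simp [gbar, Finset.sum_apply, div_eq_inv_mul]

lemma tendsto_Sig (hD : D.Admissible 𝒳 V) (hS : D.IsSample X Y P β₀ 𝒳) (hβ₀ : β₀ ∈ V)
    (h2 : D.C2 X Y P β₀) (hint : ∀ a, Integrable (fun ω => D.moment β₀ (X 0 ω) (Y 0 ω) a) P)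
    (a b : MIdx p q L K) :
    Tendsto (fun i : ℕ × Ω => D.Sig X Y i.1 β₀ i.2 a b) (inProb P)
      (𝓝 (D.momentCov X Y P β₀ a b)) := by
  obtain ⟨F, hF, hFeq⟩ := exists_measurable_extend_prod hD.measurableSet_covariates
    (f := fun x y => D.moment β₀ x y a * D.moment β₀ x y b)
    ((hD.measurable_moment hβ₀ a).mul (hD.measurable_moment hβ₀ b))
  have hFω : ∀ i ω, F (X i ω, Y i ω) =
      D.moment β₀ (X i ω) (Y i ω) a * D.moment β₀ (X i ω) (Y i ω) b :=
    fun i ω => hFeq _ (hS.X_mem i ω) _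
  have h := hS.tendsto_mean hF (by
    simp only [hFω]
    exact (h2.memLp_moment hint a).integrable_mul (h2.memLp_moment hint b))
  simp only [hFω, integral_moment_mul hD hS hβ₀ h2 hint] at h
  refine h.congr fun i => ?_
  simp [Sig, Matrix.sum_apply, Matrix.vecMulVec_apply, div_eq_inv_mul]

lemma tendsto_Jac (hD : D.Admissible 𝒳 V) (hS : D.IsSample X Y P β₀ 𝒳)
    (hV : IsOpen V) (hβ₀ : β₀ ∈ V) (h3 : D.C3 𝒳 V) (h5 : D.C5 X Y P β₀ V) (a : MIdx p q L K)
    (h : Fin p) :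
    Tendsto (fun i : ℕ × Ω => D.Jac X Y i.1 β₀ i.2 a h) (inProb P)
      (𝓝 (D.momentJac X P β₀ a h)) := by
  obtain ⟨-, F, -, -, hF, -, -, -, hFeq⟩ := exists_measurable_fderiv hD hS hV hβ₀ h5 a h
  have hlim := hS.tendsto_mean hF ((h5.integrable_jac a h).congr
    ((hFeq 0).mono fun ω hω => hω.symm))
  rw [integral_congr_ae (hFeq 0), integral_fderiv_moment hD hS hV hβ₀ h3 h5] at hlim
  refine hlim.congr' (eventually_inProb_of_ae fun n => ?_)
  filter_upwards [ae_all_iff.2 hFeq, h5.jac_eq hV n] with ω h1 h2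
  rw [h2 β₀ hβ₀ a h]
  simp only [h1]

end PopulationLimits

/-! ### Full rank and the information matrix -/

section Information

variable {p q L K : ℕ} {D : Spec p q L K} {𝒳 : Set (Fin q → Fin p → ℝ)}
  {V Θ : Set (EuclideanSpace ℝ (Fin p))} {β₀ : EuclideanSpace ℝ (Fin p)}
  {Ω : Type*} [MeasurableSpace Ω] {P : Measure Ω} [IsProbabilityMeasure P]
  {X : ℕ → Ω → Fin q → Fin p → ℝ} {Y : ℕ → Ω → Fin q → ℝ}

omit [IsProbabilityMeasure P] in
lemma sum_qifCoef_mul (x : Fin q → Fin p → ℝ) (c : Fin p → ℝ) (l : Fin L) (j : Fin q) :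
    ∑ k, c k * D.qifCoef β₀ x (l, k) j = ((D.muDot β₀ x *ᵥ c) ᵥ* D.W l β₀ x) j := by
  simp only [qifCoef, Matrix.vecMul, Matrix.mulVec, dotProduct, Finset.mul_sum, Finset.sum_mul]
  rw [Finset.sum_comm]
  exact Finset.sum_congr rfl fun i _ => Finset.sum_congr rfl fun k _ => by ring

/-- The combination of the `W^{(l)}` with the coefficients of the inverse working correlation
matrix `R⁻¹` is `A^{-1/2} R⁻¹ A^{-1/2}`, as a quadratic form. -/
lemma sum_W_form (x : Fin q → Fin p → ℝ) (α : Fin L → ℝ) {R : Matrix (Fin q) (Fin q) ℝ}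
    (hR : R⁻¹ = ∑ l, α l • D.M l) (v : Fin q → ℝ) :
    ∑ l, α l * ((v ᵥ* D.W l β₀ x) ⬝ᵥ v) =
      (fun j => (√(D.A β₀ x j))⁻¹ * v j) ⬝ᵥ (R⁻¹ *ᵥ fun j => (√(D.A β₀ x j))⁻¹ * v j) := by
  rw [hR]
  simp only [Matrix.vecMul, Matrix.mulVec, dotProduct, W_apply, Matrix.sum_apply,
    Matrix.smul_apply, smul_eq_mul, Finset.mul_sum, Finset.sum_mul]
  rw [Finset.sum_comm_cycle]
  refine Finset.sum_congr rfl fun i _ => ?_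
  rw [Finset.sum_comm]
  refine Finset.sum_congr rfl fun j _ => Finset.sum_congr rfl fun l _ => ?_
  ring

/-- `B₁` has full column rank: if `B₁ c = 0` then `∂μ c = 0` almost surely, whence the linear
combination `∑ c_m S_{(l, m)}` vanishes almost surely, and `Σ₁` is nonsingular. -/
lemma injective_B1 (hD : D.Admissible 𝒳 V) (hS : D.IsSample X Y P β₀ 𝒳) (hV : IsOpen V)
    (hβ₀ : β₀ ∈ V) (h1 : D.C1 X Y P β₀ Θ) (h2 : D.C2 X Y P β₀) (h3 : D.C3 𝒳 V)
    (h5 : D.C5 X Y P β₀ V) : Function.Injective (D.B1 X P β₀).mulVec := by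
  obtain ⟨α, R, hR, -, hRinv⟩ := hD.working_corr
  refine (injective_iff_map_eq_zero (Matrix.mulVecLin (D.B1 X P β₀))).2 fun c hc => ?_
  have hc : D.B1 X P β₀ *ᵥ c = 0 := hc
  rcases Nat.eq_zero_or_pos L with rfl | hL
  · -- no basis matrix: the working correlation matrix is empty, and so is the moment function
    have hq : IsEmpty (Fin q) := by
      by_contra hne
      rw [not_isEmpty_iff] at hne
      obtain ⟨j⟩ := hne
      have := hR.inv.diag_pos (i := j)
      simp [hRinv] at this
    have hE : ∀ β ∈ Θ, β = β₀ := fun β hβ => h1.unique β hβ fun a => by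
      rcases a with a | a
      · exact a.1.elim0
      · exact hq.elim a.2
    have hcont : Tendsto (fun t : ℝ => β₀ + t • WithLp.toLp 2 c) (𝓝[≠] 0) (𝓝 β₀) := by
      have hcc : Continuous fun t : ℝ => β₀ + t • WithLp.toLp 2 c := by fun_prop
      have := hcc.tendsto 0
      rw [zero_smul, add_zero] at this
      exact this.mono_left nhdsWithin_le_nhds
    obtain ⟨t, ht, ht0⟩ := ((hcont.eventually (mem_interior_iff_mem_nhds.1 h1.mem_interior)).and
      (eventually_mem_nhdsWithin : ∀ᶠ t in 𝓝[≠] (0 : ℝ), t ∈ ({0}ᶜ : Set ℝ))).exists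
    have h0 : t • WithLp.toLp 2 c = 0 := by simpa using hE _ ht
    have h0' := (smul_eq_zero.1 h0).resolve_left ht0
    simpa using congrArg WithLp.ofLp h0'
  · set d : Ω → Fin q → ℝ := fun ω => D.muDot β₀ (X 0 ω) *ᵥ c with hd
    have hform : ∀ l ω, ∑ k, ∑ h, c k * c h *
        (-∑ j, D.qifCoef β₀ (X 0 ω) (l, k) j * D.muDot β₀ (X 0 ω) j h) =
        -((d ω ᵥ* D.W l β₀ (X 0 ω)) ⬝ᵥ d ω) := by
      intro l ω
      have h1 : (d ω ᵥ* D.W l β₀ (X 0 ω)) ⬝ᵥ d ω =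
          ∑ j, (∑ k, c k * D.qifCoef β₀ (X 0 ω) (l, k) j) *
            ∑ h, D.muDot β₀ (X 0 ω) j h * c h := by
        simp only [sum_qifCoef_mul]
        rfl
      rw [h1]
      simp only [Finset.mul_sum, Finset.sum_mul, mul_neg, Finset.sum_neg_distrib]
      congr 1
      rw [Finset.sum_comm_cycle]
      rw [Finset.sum_congr rfl fun k _ => Finset.sum_comm]
      exact Finset.sum_congr rfl fun j _ => Finset.sum_congr rfl fun k _ =>
        Finset.sum_congr rfl fun h _ => by ring
    have hI : ∀ l k h, Integrable (fun ω => c k * c h *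
        (-∑ j, D.qifCoef β₀ (X 0 ω) (l, k) j * D.muDot β₀ (X 0 ω) j h)) P := fun l k h =>
      (integral_fderiv_qif hD hS hV hβ₀ h3 h5 (l, k) h).1.const_mul _
    have hIl : ∀ l, Integrable (fun ω => -((d ω ᵥ* D.W l β₀ (X 0 ω)) ⬝ᵥ d ω)) P := fun l => by
      simp only [← hform]
      exact integrable_finsetSum _ fun k _ => integrable_finsetSum _ fun h _ => hI l k h
    have hzero : ∀ l, ∫ ω, -((d ω ᵥ* D.W l β₀ (X 0 ω)) ⬝ᵥ d ω) ∂P = 0 := by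
      intro l
      simp only [← hform]
      rw [integral_finsetSum _ fun k _ => integrable_finsetSum _ fun h _ => hI l k h]
      refine Finset.sum_eq_zero fun k _ => ?_
      rw [integral_finsetSum _ fun h _ => hI l k h]
      have := congrFun hc (l, k)
      simp only [Matrix.mulVec, dotProduct, B1_apply, Pi.zero_apply] at this
      calc _ = c k * ∑ h, (∫ ω, -∑ j, D.qifCoef β₀ (X 0 ω) (l, k) j *
              D.muDot β₀ (X 0 ω) j h ∂P) * c h := by
            rw [Finset.mul_sum]
            refine Finset.sum_congr rfl fun h _ => ?_
            rw [integral_const_mul]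
            ring
        _ = 0 := by rw [this, mul_zero]
    set u : Ω → Fin q → ℝ := fun ω j => (√(D.A β₀ (X 0 ω) j))⁻¹ * d ω j with hu
    -- the forms of the `W^{(l)}` at `d` have mean zero, hence so does the definite form of `R⁻¹`
    have hsum : ∀ ω, u ω ⬝ᵥ (R⁻¹ *ᵥ u ω) =
        -∑ l, α l * -((d ω ᵥ* D.W l β₀ (X 0 ω)) ⬝ᵥ d ω) := by
      intro ω
      rw [hu, ← sum_W_form (X 0 ω) α hRinv (d ω)]
      simp
    have hae : (fun ω => u ω ⬝ᵥ (R⁻¹ *ᵥ u ω)) =ᵐ[P] 0 := by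
      refine (integral_eq_zero_iff_of_nonneg (fun ω => ?_) ?_).1 ?_
      · simpa using hR.inv.posSemidef.dotProduct_mulVec_nonneg (u ω)
      · simp only [hsum]
        exact (integrable_finsetSum _ fun l _ => (hIl l).const_mul _).neg
      · simp only [hsum]
        rw [integral_neg, integral_finsetSum _ fun l _ => (hIl l).const_mul _]
        simp only [integral_const_mul, hzero, mul_zero, Finset.sum_const_zero, neg_zero]
    have hd0 : ∀ᵐ ω ∂P, d ω = 0 := by
      filter_upwards [hae] with ω hω
      have hu0 : u ω = 0 := by
        by_contra hne
        have := hR.inv.dotProduct_mulVec_pos hne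
        simp only [star_trivial] at this
        exact this.ne' hω
      ext j
      have hj := congrFun hu0 j
      simp only [hu, Pi.zero_apply, mul_eq_zero, inv_eq_zero] at hj
      exact hj.resolve_left (Real.sqrt_pos.2 (hD.A_pos (hS.X_mem 0 ω) hβ₀ j)).ne'
    have hqif : ∀ᵐ ω ∂P, ∑ a : Fin L × Fin p, D.qif β₀ (X 0 ω) (Y 0 ω) a * c a.2 = 0 := by
      filter_upwards [hd0] with ω hω
      rw [Fintype.sum_prod_type]
      refine Finset.sum_eq_zero fun l _ => ?_
      have : ∀ k, D.qif β₀ (X 0 ω) (Y 0 ω) (l, k) * c k =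
          ∑ j, c k * D.qifCoef β₀ (X 0 ω) (l, k) j * (Y 0 ω j - D.mu β₀ (X 0 ω) j) := by
        intro k
        rw [qif_eq, mul_comm, Finset.mul_sum]
        exact Finset.sum_congr rfl fun j _ => by ring
      simp only [this]
      rw [Finset.sum_comm]
      refine Finset.sum_eq_zero fun j _ => ?_
      rw [← Finset.sum_mul, sum_qifCoef_mul]
      change ((d ω) ᵥ* _) j * _ = 0
      simp [hω]
    have hS1 : D.Sigma1 X Y P β₀ *ᵥ (fun a => c a.2) = 0 := by
      ext a
      simp only [Matrix.mulVec, dotProduct, Sigma1, Matrix.of_apply, Pi.zero_apply]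
      simp only [← integral_mul_const]
      rw [← integral_finsetSum _ fun b _ => (h2.finite1 a b).mul_const _]
      refine integral_eq_zero_of_ae ?_
      filter_upwards [hqif] with ω hω
      simp only [mul_assoc]
      rw [← Finset.mul_sum, hω]
      simp
    have hw : (fun a : Fin L × Fin p => c a.2) = 0 :=
      Matrix.mulVec_injective_of_isUnit h2.posDef1.isUnit (by rw [hS1, Matrix.mulVec_zero])
    ext k
    exact congrFun hw (⟨0, hL⟩, k)

omit [IsProbabilityMeasure P] in
lemma information_posDef (h2 : D.C2 X Y P β₀) (hB : Function.Injective (D.B1 X P β₀).mulVec) :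
    ((D.B1 X P β₀)ᵀ * (D.Sigma1 X Y P β₀)⁻¹ * D.B1 X P β₀ +
      (D.B2 X P β₀)ᵀ * (D.Sigma2 X P β₀)⁻¹ * D.B2 X P β₀).PosDef := by
  refine Matrix.PosDef.add_posSemidef ?_ ?_
  · simpa using h2.posDef1.inv.conjTranspose_mul_mul_same hB
  · simpa using h2.posDef2.inv.posSemidef.conjTranspose_mul_mul_same (D.B2 X P β₀)

omit [IsProbabilityMeasure P] in
lemma information_eq (h2 : D.C2 X Y P β₀) :
    (D.momentJac X P β₀)ᵀ * (D.momentCov X Y P β₀)⁻¹ * D.momentJac X P β₀ =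
      (D.B1 X P β₀)ᵀ * (D.Sigma1 X Y P β₀)⁻¹ * D.B1 X P β₀ +
      (D.B2 X P β₀)ᵀ * (D.Sigma2 X P β₀)⁻¹ * D.B2 X P β₀ := by
  have hd1 : IsUnit (D.Sigma1 X Y P β₀).det :=
    (Matrix.isUnit_iff_isUnit_det _).1 h2.posDef1.isUnit
  have hd2 : IsUnit (D.Sigma2 X P β₀).det :=
    (Matrix.isUnit_iff_isUnit_det _).1 h2.posDef2.isUnit
  have hinv : (D.momentCov X Y P β₀)⁻¹ =
      Matrix.fromBlocks (D.Sigma1 X Y P β₀)⁻¹ 0 0 (D.Sigma2 X P β₀)⁻¹ := by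
    refine Matrix.inv_eq_right_inv ?_
    rw [momentCov, Matrix.fromBlocks_multiply]
    simp [Matrix.mul_nonsing_inv _ hd1, Matrix.mul_nonsing_inv _ hd2]
  rw [hinv, momentJac, Matrix.transpose_fromRows, Matrix.fromCols_mul_fromBlocks,
    Matrix.fromCols_mul_fromRows]
  simp

end Information

end Spec

/-! ### Central limit theorem for the moments -/

namespace Spec

section CentralLimit

variable {p q L K : ℕ} {D : Spec p q L K} {𝒳 : Set (Fin q → Fin p → ℝ)}
  {V Θ : Set (EuclideanSpace ℝ (Fin p))} {β₀ : EuclideanSpace ℝ (Fin p)}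
  {Ω : Type*} [MeasurableSpace Ω] {P : Measure Ω} [IsProbabilityMeasure P]
  {X : ℕ → Ω → Fin q → Fin p → ℝ} {Y : ℕ → Ω → Fin q → ℝ}

omit [IsProbabilityMeasure P] in
lemma measurable_moment_sample (hD : D.Admissible 𝒳 V) (hS : D.IsSample X Y P β₀ 𝒳)
    (hβ₀ : β₀ ∈ V) (i : ℕ) (a : MIdx p q L K) :
    Measurable fun ω => D.moment β₀ (X i ω) (Y i ω) a := by
  obtain ⟨F, hF, hFeq⟩ := exists_measurable_extend_prod hD.measurableSet_covariates
    (f := fun x y => D.moment β₀ x y a) (hD.measurable_moment hβ₀ a)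
  simp only [← hFeq _ (hS.X_mem i _)]
  exact hF.comp ((hS.X_measurable i).prodMk (hS.Y_measurable i))

omit [IsProbabilityMeasure P] in
lemma measurable_scaled_gbar (hD : D.Admissible 𝒳 V) (hS : D.IsSample X Y P β₀ 𝒳)
    (hβ₀ : β₀ ∈ V) {κ : Type*} [Fintype κ] (C : Matrix κ (MIdx p q L K) ℝ) (n : ℕ) :
    Measurable fun ω =>
      (WithLp.toLp 2 (C *ᵥ (√(n : ℝ) • D.gbar X Y n β₀ ω)) : EuclideanSpace ℝ κ) := by
  have hg : ∀ a, Measurable fun ω => (√(n : ℝ) • D.gbar X Y n β₀ ω) a := fun a => by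
    simp only [gbar, Pi.smul_apply, Finset.sum_apply, smul_eq_mul]
    exact ((Finset.measurable_fun_sum _ fun i _ =>
      measurable_moment_sample hD hS hβ₀ i a).const_mul _).const_mul _
  refine (WithLp.measurable_toLp 2 _).comp (measurable_pi_lambda _ fun k => ?_)
  simp only [Matrix.mulVec, dotProduct]
  exact Finset.measurable_fun_sum _ fun a _ => (hg a).const_mul _

/-- Central limit theorem for linear images of the sample moments at `β₀`, reduced to the real one
by characteristic functions. -/
lemma tendsto_charFun_gbar (hD : D.Admissible 𝒳 V) (hS : D.IsSample X Y P β₀ 𝒳)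
    (hβ₀ : β₀ ∈ V) (h2 : D.C2 X Y P β₀)
    (hint : ∀ a, Integrable (fun ω => D.moment β₀ (X 0 ω) (Y 0 ω) a) P)
    (hzero : ∀ a, ∫ ω, D.moment β₀ (X 0 ω) (Y 0 ω) a ∂P = 0)
    (hT : (D.momentCov X Y P β₀).PosSemidef) {κ : Type*} [Fintype κ] [DecidableEq κ]
    (C : Matrix κ (MIdx p q L K) ℝ)
    (t : EuclideanSpace ℝ κ) :
    Tendsto (fun n : ℕ => charFun (P.map fun ω =>
      (WithLp.toLp 2 (C *ᵥ (√(n : ℝ) • D.gbar X Y n β₀ ω)) : EuclideanSpace ℝ κ)) t) atTop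
      (𝓝 (charFun (multivariateGaussian 0 (C * D.momentCov X Y P β₀ * Cᵀ)) t)) := by
  have hex : ∀ a, ∃ F : (Fin q → Fin p → ℝ) × (Fin q → ℝ) → ℝ, Measurable F ∧
      ∀ x ∈ 𝒳, ∀ y, F (x, y) = D.moment β₀ x y a := fun a =>
    exists_measurable_extend_prod hD.measurableSet_covariates
      (f := fun x y => D.moment β₀ x y a) (hD.measurable_moment hβ₀ a)
  choose F hF hFeq using hex
  have hFω : ∀ a i ω, F a (X i ω, Y i ω) = D.moment β₀ (X i ω) (Y i ω) a :=
    fun a i ω => hFeq a _ (hS.X_mem i ω) _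
  have hmom := measurable_moment_sample hD hS hβ₀
  have hζ := measurable_scaled_gbar hD hS hβ₀ C
  have hpsd : (C * D.momentCov X Y P β₀ * Cᵀ).PosSemidef := by
    simpa using hT.mul_mul_conjTranspose_same C
  rw [charFun_multivariateGaussian hpsd]
  -- the projection on `t` is a normalized sum of real variables
  set w : MIdx p q L K → ℝ := t.ofLp ᵥ* C with hw
  set U : ℕ → Ω → ℝ := fun i ω => ∑ a, w a * D.moment β₀ (X i ω) (Y i ω) a with hU
  have hproj : ∀ (n : ℕ) ω,
      inner ℝ (WithLp.toLp 2 (C *ᵥ (√(n : ℝ) • D.gbar X Y n β₀ ω)) : EuclideanSpace ℝ κ) t =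
        (√(n : ℝ))⁻¹ * ∑ i ∈ Finset.range n, U i ω := by
    intro n ω
    have h1 : inner ℝ (WithLp.toLp 2 (C *ᵥ (√(n : ℝ) • D.gbar X Y n β₀ ω)) :
        EuclideanSpace ℝ κ) t = w ⬝ᵥ (√(n : ℝ) • D.gbar X Y n β₀ ω) := by
      rw [hw, ← Matrix.dotProduct_mulVec]
      simp [PiLp.inner_apply, dotProduct]
    have h3 : √(n : ℝ) * (n : ℝ)⁻¹ = (√(n : ℝ))⁻¹ := by
      rw [← div_eq_mul_inv, Real.sqrt_div_self]
    rw [h1, dotProduct_smul, gbar, dotProduct_smul, smul_eq_mul, smul_eq_mul, ← mul_assoc, h3]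
    congr 1
    simp only [hU, dotProduct, Finset.sum_apply, Finset.mul_sum]
    rw [Finset.sum_comm]
  have hL2 : ∀ a, MemLp (fun ω => D.moment β₀ (X 0 ω) (Y 0 ω) a) 2 P := h2.memLp_moment hint
  have hUL2 : MemLp (U 0) 2 P := memLp_finsetSum _ fun a _ => (hL2 a).const_mul _
  have hU0 : ∫ ω, U 0 ω ∂P = 0 := by
    simp only [hU]
    rw [integral_finsetSum _ fun a _ => (hint a).const_mul _]
    simp [integral_const_mul, hzero]
  have hvar : Var[U 0; P] = t.ofLp ⬝ᵥ ((C * D.momentCov X Y P β₀ * Cᵀ) *ᵥ t.ofLp) := by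
    rw [variance_of_integral_eq_zero hUL2.aestronglyMeasurable.aemeasurable hU0]
    have h1 : t.ofLp ⬝ᵥ ((C * D.momentCov X Y P β₀ * Cᵀ) *ᵥ t.ofLp) =
        w ⬝ᵥ (D.momentCov X Y P β₀ *ᵥ w) := by
      rw [← Matrix.mulVec_mulVec, ← Matrix.mulVec_mulVec, Matrix.dotProduct_mulVec,
        Matrix.mulVec_transpose]
    have hI : ∀ a b, Integrable (fun ω => w a * (w b * (D.moment β₀ (X 0 ω) (Y 0 ω) a *
        D.moment β₀ (X 0 ω) (Y 0 ω) b))) P := fun a b =>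
      (((hL2 a).integrable_mul (hL2 b)).const_mul _).const_mul _
    have hsq : ∀ ω, (U 0 ω) ^ 2 = ∑ a, ∑ b, w a * (w b * (D.moment β₀ (X 0 ω) (Y 0 ω) a *
        D.moment β₀ (X 0 ω) (Y 0 ω) b)) := by
      intro ω
      rw [sq, hU, Finset.sum_mul_sum]
      exact Finset.sum_congr rfl fun a _ => Finset.sum_congr rfl fun b _ => by ring
    rw [h1, integral_congr_ae (Eventually.of_forall hsq),
      integral_finsetSum _ fun a _ => integrable_finsetSum _ fun b _ => hI a b]
    simp only [dotProduct, Matrix.mulVec, Finset.mul_sum]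
    refine Finset.sum_congr rfl fun a _ => ?_
    rw [integral_finsetSum _ fun b _ => hI a b]
    refine Finset.sum_congr rfl fun b _ => ?_
    rw [integral_const_mul, integral_const_mul, integral_moment_mul hD hS hβ₀ h2 hint]
    ring
  have hFU : Measurable fun z => ∑ a, w a * F a z :=
    Finset.measurable_fun_sum _ fun a _ => (hF a).const_mul _
  have hUF : U = fun i ω => (fun z => ∑ a, w a * F a z) (X i ω, Y i ω) := by
    ext i ω
    simp only [hU, hFω]
  have hindep : iIndepFun U P := by
    rw [hUF]
    exact hS.indep.comp (fun _ z => ∑ a, w a * F a z) fun _ => hFU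
  have hident : ∀ i, IdentDistrib (U i) (U 0) P P := by
    rw [hUF]
    exact fun i => (hS.identDistrib i).comp hFU
  have hclt := tendstoInDistribution_inv_sqrt_mul_sum_sub
    (P' := gaussianReal 0 Var[U 0; P].toNNReal) HasLaw.id hUL2 hindep hident
  have hlim := ProbabilityMeasure.tendsto_iff_tendsto_charFun.1 hclt.tendsto 1
  simp only [ProbabilityMeasure.coe_mk, Measure.map_id, charFun_gaussianReal, hU0, mul_zero,
    sub_zero] at hlim
  refine (hlim.congr fun n => ?_).trans_eq ?_
  · have hm : Measurable fun ω => (√(n : ℝ))⁻¹ * ∑ i ∈ Finset.range n, U i ω :=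
      (Finset.measurable_fun_sum _ fun i _ =>
        Finset.measurable_fun_sum _ fun a _ => (hmom i a).const_mul _).const_mul _
    rw [charFun_apply, charFun_apply, integral_map hm.aemeasurable (by fun_prop),
      integral_map (hζ n).aemeasurable (by fun_prop)]
    simp [hproj]
  · rw [Real.coe_toNNReal _ (variance_nonneg _ _), hvar]
    simp

lemma tendstoInDistribution_gbar (hD : D.Admissible 𝒳 V) (hS : D.IsSample X Y P β₀ 𝒳)
    (hβ₀ : β₀ ∈ V) (h2 : D.C2 X Y P β₀)
    (hint : ∀ a, Integrable (fun ω => D.moment β₀ (X 0 ω) (Y 0 ω) a) P)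
    (hzero : ∀ a, ∫ ω, D.moment β₀ (X 0 ω) (Y 0 ω) a ∂P = 0)
    (hT : (D.momentCov X Y P β₀).PosSemidef) {κ : Type*} [Fintype κ] [DecidableEq κ]
    (C : Matrix κ (MIdx p q L K) ℝ) :
    TendstoInDistribution (fun (n : ℕ) ω =>
      (WithLp.toLp 2 (C *ᵥ (√(n : ℝ) • D.gbar X Y n β₀ ω)) : EuclideanSpace ℝ κ)) atTop
      (id : EuclideanSpace ℝ κ → EuclideanSpace ℝ κ) (fun _ => P)
      (multivariateGaussian 0 (C * D.momentCov X Y P β₀ * Cᵀ)) where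
  forall_aemeasurable n := (measurable_scaled_gbar hD hS hβ₀ C n).aemeasurable
  tendsto := by
    refine ProbabilityMeasure.tendsto_iff_tendsto_charFun.2 fun t => ?_
    simpa using tendsto_charFun_gbar hD hS hβ₀ h2 hint hzero hT C t

/-- The normalized sample moments at `β₀` are bounded in probability. -/
lemma exists_bound_gbar (hD : D.Admissible 𝒳 V) (hS : D.IsSample X Y P β₀ 𝒳)
    (hβ₀ : β₀ ∈ V) (h2 : D.C2 X Y P β₀)
    (hint : ∀ a, Integrable (fun ω => D.moment β₀ (X 0 ω) (Y 0 ω) a) P)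
    (hzero : ∀ a, ∫ ω, D.moment β₀ (X 0 ω) (Y 0 ω) a ∂P = 0)
    (hT : (D.momentCov X Y P β₀).PosSemidef) {η : ENNReal} (hη : 0 < η) :
    ∃ M : ℝ, ∀ n : ℕ, P {ω | M < ‖√(n : ℝ) • D.gbar X Y n β₀ ω‖} ≤ η := by
  have hm := fun n => (measurable_scaled_gbar hD hS hβ₀
    (1 : Matrix (MIdx p q L K) (MIdx p q L K) ℝ) n).aemeasurable (μ := P)
  have : ∀ n : ℕ, IsProbabilityMeasure (P.map fun ω =>
      (WithLp.toLp 2 ((1 : Matrix (MIdx p q L K) (MIdx p q L K) ℝ) *ᵥ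
        (√(n : ℝ) • D.gbar X Y n β₀ ω)) : EuclideanSpace ℝ (MIdx p q L K))) :=
    fun n => Measure.isProbabilityMeasure_map (hm n)
  have htight := isTightMeasureSet_of_tendsto_charFun (continuous_charFun.continuousAt)
    (tendsto_charFun_gbar hD hS hβ₀ h2 hint hzero hT
      (1 : Matrix (MIdx p q L K) (MIdx p q L K) ℝ))
  obtain ⟨M, hM⟩ := ((tendsto_measure_norm_gt_of_isTightMeasureSet htight).eventually_le_const
    hη).exists
  refine ⟨M, fun n => ?_⟩
  have h1 := (le_iSup₂_of_le _ (Set.mem_range_self n) le_rfl).trans hM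
  refine le_trans (measure_mono fun ω hω => ?_) ((Measure.le_map_apply (hm n) _).trans h1)
  simp only [Set.mem_ofPred_eq, Set.mem_preimage, Matrix.one_mulVec] at hω ⊢
  exact hω.trans_le (pi_norm_le_iff_of_nonneg (norm_nonneg _) |>.2
    fun a => PiLp.norm_apply_le (WithLp.toLp 2 (√(n : ℝ) • D.gbar X Y n β₀ ω)) a)

end CentralLimit

end Spec

/-! ### Generalized least squares -/

section GeneralizedLeastSquares

variable {m k : Type*} [Fintype m] [DecidableEq m] [Fintype k] [DecidableEq k]
  {T : Matrix m m ℝ} {B : Matrix m k ℝ}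

/-- If `z` has covariance matrix `T`, then `(BᵀT⁻¹B)⁻¹` is the covariance matrix of
`-(BᵀT⁻¹B)⁻¹BᵀT⁻¹z`. -/
lemma gls_covariance (hT : T.PosDef) (hJ : (Bᵀ * T⁻¹ * B).PosDef) :
    -((Bᵀ * T⁻¹ * B)⁻¹ * Bᵀ * T⁻¹) * T * (-((Bᵀ * T⁻¹ * B)⁻¹ * Bᵀ * T⁻¹))ᵀ =
      (Bᵀ * T⁻¹ * B)⁻¹ := by
  have hTd : IsUnit T.det := (Matrix.isUnit_iff_isUnit_det _).1 hT.isUnit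
  have hJd : IsUnit (Bᵀ * T⁻¹ * B).det := (Matrix.isUnit_iff_isUnit_det _).1 hJ.isUnit
  have hTs : (T⁻¹)ᵀ = T⁻¹ := by simpa using hT.inv.1.eq
  have hJs : ((Bᵀ * T⁻¹ * B)⁻¹)ᵀ = (Bᵀ * T⁻¹ * B)⁻¹ := by simpa using hJ.inv.1.eq
  rw [Matrix.transpose_neg, Matrix.neg_mul, Matrix.neg_mul, Matrix.mul_neg, neg_neg,
    Matrix.transpose_mul, Matrix.transpose_mul, hTs, hJs, Matrix.transpose_transpose,
    Matrix.nonsing_inv_mul_cancel_right _ _ hTd]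
  calc (Bᵀ * T⁻¹ * B)⁻¹ * Bᵀ * (T⁻¹ * (B * (Bᵀ * T⁻¹ * B)⁻¹))
      = (Bᵀ * T⁻¹ * B)⁻¹ * (Bᵀ * T⁻¹ * B) * (Bᵀ * T⁻¹ * B)⁻¹ := by simp only [Matrix.mul_assoc]
    _ = _ := by rw [Matrix.nonsing_inv_mul _ hJd, Matrix.one_mul]

/-- The normal equations of generalized least squares. -/
lemma gls_normal_equations (hJ : (Bᵀ * T⁻¹ * B).PosDef) (z : m → ℝ) (v : k → ℝ) :
    (B *ᵥ v) ⬝ᵥ (T⁻¹ *ᵥ (z - B *ᵥ (((Bᵀ * T⁻¹ * B)⁻¹ * Bᵀ * T⁻¹) *ᵥ z))) = 0 := by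
  have hJd : IsUnit (Bᵀ * T⁻¹ * B).det := (Matrix.isUnit_iff_isUnit_det _).1 hJ.isUnit
  have h : Bᵀ *ᵥ (T⁻¹ *ᵥ (z - B *ᵥ (((Bᵀ * T⁻¹ * B)⁻¹ * Bᵀ * T⁻¹) *ᵥ z))) = 0 := by
    simp only [Matrix.mulVec_sub, Matrix.mulVec_mulVec]
    rw [show Bᵀ * (T⁻¹ * (B * ((Bᵀ * T⁻¹ * B)⁻¹ * Bᵀ * T⁻¹))) =
      (Bᵀ * T⁻¹ * B) * (Bᵀ * T⁻¹ * B)⁻¹ * (Bᵀ * T⁻¹) by simp only [Matrix.mul_assoc],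
      Matrix.mul_nonsing_inv _ hJd, Matrix.one_mul, sub_self]
  rw [dotProduct_comm, Matrix.dotProduct_mulVec, ← Matrix.mulVec_transpose, h, zero_dotProduct]

end GeneralizedLeastSquares

lemma tendstoUniformlyOn_of_apply {ι α κ : Type*} [Fintype κ] {l : Filter ι} {s : Set α}
    {F : ι → α → κ → ℝ} {f : α → κ → ℝ}
    (h : ∀ a, TendstoUniformlyOn (fun i x => F i x a) (fun x => f x a) l s) :
    TendstoUniformlyOn F f l s := by
  rw [Metric.tendstoUniformlyOn_iff]
  intro ε hε
  filter_upwards [eventually_all.2 fun a => Metric.tendstoUniformlyOn_iff.1 (h a) ε hε]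
    with i hi x hx
  exact (dist_pi_lt_iff hε).2 fun a => hi a x hx

/-- Convergence in probability may be checked on the events where a tight sequence is bounded. -/
lemma tendstoInMeasure_of_bounded {Ω E F : Type*} [MeasurableSpace Ω] {P : Measure Ω}
    [SeminormedAddCommGroup E] [Norm F] {δ : ℕ → Ω → E} {Z : ℕ → Ω → F}
    (hZ : ∀ η : ENNReal, 0 < η → ∃ M : ℝ, ∀ n, P {ω | M < ‖Z n ω‖} ≤ η)
    (h : ∀ M : ℝ, Tendsto (fun i : ℕ × Ω => δ i.1 i.2) (inProb P ⊓ 𝓟 {i | ‖Z i.1 i.2‖ ≤ M})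
      (𝓝 0)) :
    TendstoInMeasure P δ atTop 0 := by
  rw [tendstoInMeasure_iff_norm]
  intro ε hε
  rw [ENNReal.tendsto_nhds_zero]
  intro η hη
  obtain ⟨M, hM⟩ := hZ (η / 2) (ENNReal.half_pos hη.ne')
  have h1 : ∀ᶠ i in inProb P, ‖Z i.1 i.2‖ ≤ M → ‖δ i.1 i.2‖ < ε := by
    have := Metric.tendsto_nhds.1 (h M) ε hε
    rw [eventually_inf_principal] at this
    simpa using this
  rw [eventually_inProb, ENNReal.tendsto_nhds_zero] at h1
  filter_upwards [h1 (η / 2) (ENNReal.half_pos hη.ne')] with n hn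
  calc P {ω | ε ≤ ‖δ n ω - (0 : Ω → E) ω‖}
      ≤ P ({ω | ¬(‖Z n ω‖ ≤ M → ‖δ n ω‖ < ε)} ∪ {ω | M < ‖Z n ω‖}) := by
        refine measure_mono fun ω hω => ?_
        simp only [Pi.zero_apply, sub_zero, Set.mem_ofPred_eq, Set.mem_union] at hω ⊢
        by_cases hM' : M < ‖Z n ω‖
        · exact Or.inr hM'
        · exact Or.inl fun hh => absurd (hh (not_lt.1 hM')) hω.not_gt
    _ ≤ η / 2 + η / 2 := (measure_union_le _ _).trans (add_le_add hn (hM n))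
    _ = η := ENNReal.add_halves η

/-! ### Consistency and asymptotic linearity of the estimator -/

namespace Spec

variable {p q L K : ℕ} {D : Spec p q L K} {𝒳 : Set (Fin q → Fin p → ℝ)}
  {V Θ : Set (EuclideanSpace ℝ (Fin p))} {β₀ : EuclideanSpace ℝ (Fin p)}
  {Ω : Type*} [MeasurableSpace Ω] {P : Measure Ω} [IsProbabilityMeasure P]
  {X : ℕ → Ω → Fin q → Fin p → ℝ} {Y : ℕ → Ω → Fin q → ℝ}

omit [MeasurableSpace Ω] in
lemma posSemidef_Sig (D : Spec p q L K) (X : ℕ → Ω → Fin q → Fin p → ℝ) (Y : ℕ → Ω → Fin q → ℝ)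
    (n : ℕ) (β : EuclideanSpace ℝ (Fin p)) (ω : Ω) : (D.Sig X Y n β ω).PosSemidef := by
  refine Matrix.PosSemidef.smul (Matrix.posSemidef_sum _ fun i _ => ?_) (by positivity)
  simpa using Matrix.posSemidef_vecMulVec_self_star (D.moment β (X i ω) (Y i ω))

/-- The uniform limit of the second moment matrices: its value at `β₀` is identified by the law of
large numbers, and its continuity on all of `V` is inherited from that of `Σ_n`. -/
lemma C4.exists_limit (h4 : D.C4 X Y P β₀ V) (hD : D.Admissible 𝒳 V)
    (hS : D.IsSample X Y P β₀ 𝒳) (hβ₀ : β₀ ∈ V) (h2 : D.C2 X Y P β₀)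
    (hint : ∀ a, Integrable (fun ω => D.moment β₀ (X 0 ω) (Y 0 ω) a) P) :
    ∃ Sg : EuclideanSpace ℝ (Fin p) → Matrix (MIdx p q L K) (MIdx p q L K) ℝ,
      (Sg β₀).PosDef ∧ Sg β₀ = D.momentCov X Y P β₀ ∧
      ∀ (b : ℕ × Ω → EuclideanSpace ℝ (Fin p)), ∀ c ∈ V, ∀ l' ≤ inProb P,
        Tendsto b l' (𝓝[V] c) → Tendsto (fun i => D.Sig X Y i.1 (b i) i.2) l' (𝓝 (Sg c)) := by
  obtain ⟨Sg, -, hpd, hsup⟩ := h4.limit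
  have hu : ∀ a b, TendstoUniformlyOn (fun (i : ℕ × Ω) β => D.Sig X Y i.1 β i.2 a b)
      (fun β => Sg β a b) (inProb P) V := fun a b =>
    hsup.tendstoUniformlyOn (f := fun n β ω => D.Sig X Y n β ω a b) fun n β ω =>
      abs_le_mnorm (D.Sig X Y n β ω - Sg β) a b
  have hc : ∀ a b, ContinuousOn (fun β => Sg β a b) V := fun a b =>
    (hu a b).continuousOn (eventually_inProb_of_ae fun n =>
      (h4.smooth n).mono fun ω hω => (hω a b).continuousOn).frequently
  refine ⟨Sg, hpd, ?_, fun b c hcV l' hl' hb => ?_⟩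
  · ext a b
    exact tendsto_nhds_unique ((hu a b).tendsto_at hβ₀) (tendsto_Sig hD hS hβ₀ h2 hint a b)
  · refine tendsto_pi_nhds.2 fun a => tendsto_pi_nhds.2 fun a' => ?_
    have hu' : TendstoUniformlyOn (fun (i : ℕ × Ω) β => D.Sig X Y i.1 β i.2 a a')
      (fun β => Sg β a a') l' V := fun s hs => hl' (hu a a' s hs)
    exact hu'.tendsto_comp (hc a a' c hcV) hb

/-- The uniform limit of the sample moments is continuous on all of `V`, and equal to the population
moment on `Θ`. -/
lemma C5.exists_limit (h5 : D.C5 X Y P β₀ V) (hD : D.Admissible 𝒳 V)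
    (hS : D.IsSample X Y P β₀ 𝒳) (hΘV : Θ ⊆ V) (h1 : D.C1 X Y P β₀ Θ) :
    ∃ g : EuclideanSpace ℝ (Fin p) → MIdx p q L K → ℝ, ContinuousOn g V ∧
      TendstoUniformlyOn (fun (i : ℕ × Ω) β => D.gbar X Y i.1 β i.2) g (inProb P) V ∧
      ∀ β ∈ Θ, ∀ a, g β a = ∫ ω, D.moment β (X 0 ω) (Y 0 ω) a ∂P := by
  obtain ⟨g, -, hsup⟩ := h5.limit
  have hu' : ∀ a, TendstoUniformlyOn (fun (i : ℕ × Ω) β => D.gbar X Y i.1 β i.2 a)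
      (fun β => g β a) (inProb P) V := fun a =>
    hsup.tendstoUniformlyOn (f := fun n β ω => D.gbar X Y n β ω a) fun n β ω =>
      abs_le_vnorm (D.gbar X Y n β ω - g β) a
  have hu := tendstoUniformlyOn_of_apply hu'
  refine ⟨g, hu.continuousOn (eventually_inProb_of_ae fun n => (h5.smooth n).mono fun ω hω =>
    continuousOn_pi.2 fun a => (hω a).continuousOn).frequently, hu, fun β hβ a => ?_⟩
  exact tendsto_nhds_unique ((hu' a).tendsto_at (hΘV hβ))
    (tendsto_gbar hD hS (hΘV hβ) a (h1.integrable β hβ a))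

/-- First-order expansion of the sample moments at `β₀`, with the population Jacobian matrix. -/
lemma C5.isLittleO_gbar (h5 : D.C5 X Y P β₀ V) (hD : D.Admissible 𝒳 V)
    (hS : D.IsSample X Y P β₀ 𝒳) (hV : IsOpen V) (hβ₀ : β₀ ∈ V) (h3 : D.C3 𝒳 V)
    {b : ℕ × Ω → EuclideanSpace ℝ (Fin p)} {l : Filter (ℕ × Ω)} (hl : l ≤ inProb P)
    (hb : Tendsto b l (𝓝 β₀)) :
    (fun i => D.gbar X Y i.1 (b i) i.2 - D.gbar X Y i.1 β₀ i.2 -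
      D.momentJac X P β₀ *ᵥ (b i - β₀).ofLp) =o[l] fun i => b i - β₀ := by
  obtain ⟨G, hGc, hsup⟩ := h5.limit_jac
  have hu : ∀ a h, TendstoUniformlyOn (fun (i : ℕ × Ω) β => D.Jac X Y i.1 β i.2 a h)
      (fun β => G β a h) (inProb P) V := fun a h =>
    hsup.tendstoUniformlyOn (f := fun n β ω => D.Jac X Y n β ω a h) fun n β ω =>
      abs_le_mnorm (D.Jac X Y n β ω - G β) a h
  have hB : G β₀ = D.momentJac X P β₀ := by
    ext a h
    exact tendsto_nhds_unique ((hu a h).tendsto_at hβ₀) (tendsto_Jac hD hS hV hβ₀ h3 h5 a h)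
  have hdiff : ∀ᶠ i in inProb P, ∀ β ∈ V, ∀ a,
      DifferentiableAt ℝ (fun b => D.gbar X Y i.1 b i.2 a) β :=
    eventually_inProb_of_ae fun n => (h5.smooth n).mono fun ω hω β hβ a =>
      ((hω a).contDiffAt (hV.mem_nhds hβ)).differentiableAt two_ne_zero
  rw [← hB]
  have h := isLittleO_expansion (l := l) (b := b)
    (g := fun (i : ℕ × Ω) β => D.gbar X Y i.1 β i.2)
    (hV.mem_nhds hβ₀) hGc (hl hdiff) (fun a h s hs => hl (hu a h s hs)) hb
  exact h

/-- Consistency of the estimator. -/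
lemma tendsto_estimate (hΘV : Θ ⊆ V) (hD : D.Admissible 𝒳 V)
    (hS : D.IsSample X Y P β₀ 𝒳) (h1 : D.C1 X Y P β₀ Θ) (h2 : D.C2 X Y P β₀)
    (h4 : D.C4 X Y P β₀ V) (h5 : D.C5 X Y P β₀ V) {b : ℕ × Ω → EuclideanSpace ℝ (Fin p)}
    (hb : ∀ᶠ i in inProb P, D.IsGMMEstimate X Y Θ i.1 i.2 (b i)) :
    Tendsto b (inProb P) (𝓝 β₀) := by
  have hβΘ : β₀ ∈ Θ := interior_subset h1.mem_interior
  obtain ⟨Sg, hpd, -, hSg⟩ := h4.exists_limit hD hS (hΘV hβΘ) h2 (h1.integrable β₀ hβΘ)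
  obtain ⟨g, hgc, hgu, hg⟩ := h5.exists_limit hD hS hΘV h1
  have hweight : ∀ (c : ℕ × Ω → EuclideanSpace ℝ (Fin p)), ∀ c₀ ∈ Θ, ∀ l' ≤ inProb P,
      Tendsto c l' (𝓝[Θ] c₀) → Tendsto (fun i => D.Sig X Y i.1 (c i) i.2) l' (𝓝 (Sg c₀)) :=
    fun c c₀ hc₀ l' hl' hc => hSg c c₀ (hΘV hc₀) l' hl' (hc.mono_right (nhdsWithin_mono c₀ hΘV))
  have hzero : g β₀ = 0 := by
    ext a
    rw [hg β₀ hβΘ, h1.zero, Pi.zero_apply]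
  have huniq : ∀ β ∈ Θ, g β = 0 → β = β₀ := fun β hβ h0 =>
    h1.unique β hβ fun a => by rw [← hg β hβ, h0, Pi.zero_apply]
  have h := tendsto_minimizer (b := b) (g := fun (i : ℕ × Ω) β => D.gbar X Y i.1 β i.2)
    (S := fun i β => D.Sig X Y i.1 β i.2) h1.compact hβΘ (hgu.mono hΘV) (hgc.mono hΘV) hweight
    hzero huniq ((Matrix.isUnit_iff_isUnit_det _).1 hpd.isUnit)
    (fun i β => D.posSemidef_Sig X Y i.1 β i.2) hb
  exact h

/-- The coefficient matrix `(BᵀΣ⁻¹B)⁻¹BᵀΣ⁻¹` of the generalized least squares approximation, where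
`B` and `Σ` are the expected Jacobian matrix and the covariance matrix of the moments. -/
noncomputable def glsMatrix (D : Spec p q L K) (X : ℕ → Ω → Fin q → Fin p → ℝ)
    (Y : ℕ → Ω → Fin q → ℝ) (P : Measure Ω) (β₀ : EuclideanSpace ℝ (Fin p)) :
    Matrix (Fin p) (MIdx p q L K) ℝ :=
  ((D.momentJac X P β₀)ᵀ * (D.momentCov X Y P β₀)⁻¹ * D.momentJac X P β₀)⁻¹ *
    (D.momentJac X P β₀)ᵀ * (D.momentCov X Y P β₀)⁻¹

/-- Asymptotic linearity of the estimator, on the events where the scaled moments are bounded. -/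
lemma tendsto_estimate_linearization (hV : IsOpen V) (hΘV : Θ ⊆ V) (hD : D.Admissible 𝒳 V)
    (hS : D.IsSample X Y P β₀ 𝒳) (h1 : D.C1 X Y P β₀ Θ) (h2 : D.C2 X Y P β₀) (h3 : D.C3 𝒳 V)
    (h4 : D.C4 X Y P β₀ V) (h5 : D.C5 X Y P β₀ V)
    (hJ : ((D.momentJac X P β₀)ᵀ * (D.momentCov X Y P β₀)⁻¹ * D.momentJac X P β₀).PosDef)
    {b : ℕ × Ω → EuclideanSpace ℝ (Fin p)}
    (hb : ∀ᶠ i in inProb P, D.IsGMMEstimate X Y Θ i.1 i.2 (b i)) (M : ℝ) :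
    Tendsto (fun i : ℕ × Ω => √(i.1 : ℝ) • (b i - β₀) -
      WithLp.toLp 2 ((-D.glsMatrix X Y P β₀) *ᵥ (√(i.1 : ℝ) • D.gbar X Y i.1 β₀ i.2)))
      (inProb P ⊓ 𝓟 {i | ‖√(i.1 : ℝ) • D.gbar X Y i.1 β₀ i.2‖ ≤ M}) (𝓝 0) := by
  have hβΘ : β₀ ∈ Θ := interior_subset h1.mem_interior
  have hβ₀ : β₀ ∈ V := hΘV hβΘ
  obtain ⟨Sg, hpd, hT, hSg⟩ := h4.exists_limit hD hS hβ₀ h2 (h1.integrable β₀ hβΘ)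
  set N := D.glsMatrix X Y P β₀ with hN
  obtain ⟨B, hBapp⟩ : ∃ B : EuclideanSpace ℝ (Fin p) →L[ℝ] (MIdx p q L K → ℝ),
      ∀ v, B v = D.momentJac X P β₀ *ᵥ v.ofLp :=
    ⟨LinearMap.toContinuousLinearMap ((D.momentJac X P β₀).mulVecLin ∘ₗ
      (WithLp.linearEquiv 2 ℝ (Fin p → ℝ)).toLinearMap), fun _ => rfl⟩
  obtain ⟨H, hHapp⟩ : ∃ H : (MIdx p q L K → ℝ) →L[ℝ] EuclideanSpace ℝ (Fin p),
      ∀ z, H z = WithLp.toLp 2 (N *ᵥ z) :=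
    ⟨LinearMap.toContinuousLinearMap ((WithLp.linearEquiv 2 ℝ (Fin p → ℝ)).symm.toLinearMap ∘ₗ
      N.mulVecLin), fun _ => rfl⟩
  have hBinj : Function.Injective B := by
    refine (injective_iff_map_eq_zero B).2 fun v hv => ?_
    rw [hBapp] at hv
    have h0 : ((D.momentJac X P β₀)ᵀ * (D.momentCov X Y P β₀)⁻¹ * D.momentJac X P β₀) *ᵥ
        v.ofLp = 0 := by
      rw [← Matrix.mulVec_mulVec, hv, Matrix.mulVec_zero]
    have := Matrix.mulVec_injective_of_isUnit hJ.isUnit (h0.trans (Matrix.mulVec_zero _).symm)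
    simpa using this
  set l := inProb P ⊓ 𝓟 {i : ℕ × Ω | ‖√(i.1 : ℝ) • D.gbar X Y i.1 β₀ i.2‖ ≤ M} with hl
  have hle : l ≤ inProb P := inf_le_left
  have hnormal : ∀ z v, B v ⬝ᵥ ((Sg β₀)⁻¹ *ᵥ (z - B (H z))) = 0 := by
    intro z v
    rw [hT, hBapp, hBapp, hHapp]
    exact gls_normal_equations hJ z v.ofLp
  have hexp : ∀ c : ℕ × Ω → EuclideanSpace ℝ (Fin p), ∀ l' ≤ l, Tendsto c l' (𝓝 β₀) →
      (fun i => D.gbar X Y i.1 (c i) i.2 - D.gbar X Y i.1 β₀ i.2 - B (c i - β₀)) =o[l']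
        fun i => c i - β₀ := fun c l' hl' hc => by
    simp only [hBapp]
    exact h5.isLittleO_gbar hD hS hV hβ₀ h3 (hl'.trans hle) hc
  have hweight : ∀ c : ℕ × Ω → EuclideanSpace ℝ (Fin p), ∀ l' ≤ l, Tendsto c l' (𝓝 β₀) →
      Tendsto (fun i => D.Sig X Y i.1 (c i) i.2) l' (𝓝 (Sg β₀)) := fun c l' hl' hc =>
    hSg c β₀ hβ₀ l' (hl'.trans hle) (by rwa [hV.nhdsWithin_eq hβ₀])
  have hr : Tendsto (fun i : ℕ × Ω => √(i.1 : ℝ)) l atTop :=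
    (Real.tendsto_sqrt_atTop.comp (tendsto_natCast_atTop_atTop.comp
      tendsto_fst_inProb)).mono_left hle
  have hbl := (tendsto_estimate hΘV hD hS h1 h2 h4 h5 hb).mono_left hle
  have hZ : ∀ᶠ i in l, ‖√(i.1 : ℝ) • D.gbar X Y i.1 β₀ i.2‖ ≤ M :=
    (eventually_principal.2 fun i hi => hi).filter_mono inf_le_right
  have hmin : ∀ᶠ i in l, ∀ β ∈ Θ, IsUnit (D.Sig X Y i.1 β i.2).det →
      D.gbar X Y i.1 (b i) i.2 ⬝ᵥ ((D.Sig X Y i.1 (b i) i.2)⁻¹ *ᵥ D.gbar X Y i.1 (b i) i.2) ≤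
        D.gbar X Y i.1 β i.2 ⬝ᵥ ((D.Sig X Y i.1 β i.2)⁻¹ *ᵥ D.gbar X Y i.1 β i.2) :=
    (hb.filter_mono hle).mono fun i hi => hi.2.2
  have h := tendsto_minimizer_linearization (E := EuclideanSpace ℝ (Fin p)) (m := MIdx p q L K)
    (l := l) (Θ := Θ) (β₀ := β₀) (g := fun (i : ℕ × Ω) β => D.gbar X Y i.1 β i.2)
    (S := fun (i : ℕ × Ω) β => D.Sig X Y i.1 β i.2) (T := Sg β₀) (B := B) (H := H)
    (r := fun i : ℕ × Ω => √(i.1 : ℝ)) (M := M) (b := b)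
    (mem_interior_iff_mem_nhds.1 h1.mem_interior) hpd hBinj hnormal hexp hweight hr hZ hbl hmin
  refine h.congr fun i => ?_
  rw [hHapp, Matrix.neg_mulVec, WithLp.toLp_neg, sub_neg_eq_add]

end Spec

end MarginalGMM

theorem theorem1 {p q L K : ℕ} (D : MarginalGMM.Spec p q L K)
    {Ω : Type*} [MeasurableSpace Ω] (P : Measure Ω) [IsProbabilityMeasure P]
    (X : ℕ → Ω → Fin q → Fin p → ℝ) (Y : ℕ → Ω → Fin q → ℝ)
    (𝒳 : Set (Fin q → Fin p → ℝ))
    (Θ V : Set (EuclideanSpace ℝ (Fin p))) (β₀ : EuclideanSpace ℝ (Fin p))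
    (hV : IsOpen V) (hΘV : Θ ⊆ V)
    (hD : D.Admissible 𝒳 V)
    (hS : D.IsSample X Y P β₀ 𝒳)
    (h1 : D.C1 X Y P β₀ Θ) (h2 : D.C2 X Y P β₀) (h3 : D.C3 𝒳 V)
    (h4 : D.C4 X Y P β₀ V) (h5 : D.C5 X Y P β₀ V)
    (βhat : ℕ → Ω → EuclideanSpace ℝ (Fin p))
    (hβhat_meas : ∀ n, AEMeasurable (βhat n) P)
    (hβhat : Tendsto (fun n => P {ω | ¬ D.IsGMMEstimate X Y Θ n ω (βhat n ω)}) atTop (𝓝 0)) :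
    (D.asympCov X Y P β₀).PosDef ∧
    TendstoInDistribution (fun (n : ℕ) ω => √(n : ℝ) • (βhat n ω - β₀)) atTop
      (id : EuclideanSpace ℝ (Fin p) → EuclideanSpace ℝ (Fin p)) (fun _ => P)
      (multivariateGaussian 0 (D.asympCov X Y P β₀)) := by
  have hβΘ : β₀ ∈ Θ := interior_subset h1.mem_interior
  have hβ₀ : β₀ ∈ V := hΘV hβΘ
  have hint := h1.integrable β₀ hβΘ
  have hJ := MarginalGMM.Spec.information_posDef h2
    (MarginalGMM.Spec.injective_B1 hD hS hV hβ₀ h1 h2 h3 h5)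
  have hcov : D.asympCov X Y P β₀ = ((D.momentJac X P β₀)ᵀ * (D.momentCov X Y P β₀)⁻¹ *
      D.momentJac X P β₀)⁻¹ := by
    rw [MarginalGMM.Spec.information_eq h2, MarginalGMM.Spec.asympCov]
  rw [← MarginalGMM.Spec.information_eq h2] at hJ
  refine ⟨by rw [hcov]; exact hJ.inv, ?_⟩
  obtain ⟨Sg, hpd, hT, -⟩ := h4.exists_limit hD hS hβ₀ h2 hint
  rw [hT] at hpd
  have hclt := MarginalGMM.Spec.tendstoInDistribution_gbar hD hS hβ₀ h2 hint h1.zero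
    hpd.posSemidef (-D.glsMatrix X Y P β₀)
  have hcovN : -D.glsMatrix X Y P β₀ * D.momentCov X Y P β₀ * (-D.glsMatrix X Y P β₀)ᵀ =
      D.asympCov X Y P β₀ := by
    rw [hcov]
    exact MarginalGMM.gls_covariance hpd hJ
  rw [hcovN] at hclt
  -- Slutsky: the estimator differs negligibly from a linear image of the sample moments
  refine tendstoInDistribution_of_tendstoInMeasure_sub _ _ hclt ?_ fun n => by
    have := hβhat_meas n
    fun_prop
  exact MarginalGMM.tendstoInMeasure_of_bounded
    (fun η hη => MarginalGMM.Spec.exists_bound_gbar hD hS hβ₀ h2 hint h1.zero hpd.posSemidef hη)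
    (MarginalGMM.Spec.tendsto_estimate_linearization hV hΘV hD hS h1 h2 h3 h4 h5 hJ
      (b := fun i => βhat i.1 i.2) (MarginalGMM.eventually_inProb.2 hβhat))
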